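/- Let $(M,g)$ be a smooth (Hausdorff, $\sigma$-compact) pseudo-Riemannian manifold of dimension $n$, without boundary. Write $C_c^\infty(M)$ for the algebra of smooth compactly supported complex-valued functions, $\Omega^1_c(M)$ for the smooth compactly supported complex $1$-forms, $\Gamma_c(V)$ for the smooth compactly supported sections of $V$, and $\langle\alpha,\beta\rangle=g^{ij}\alpha_i\beta_j$ (extended $\mathbb{C}$-bilinearly). **Deformed spectral triples.** A deformed spectral triple $(\mathbb{A},\mathbb{V},D)$ for $(M,g)$ consists of the following. * A smooth deformation of $M$ to second order: a commutative $\mathbb{C}$-algebra $\Bbbk$, an element $\kappa\in\Bbbk$, an associative (not necessarily unital) $\Bbbk$-algebra $\mathbb{A}$, and an isomorphism of $\mathbb{C}$-algebras $\mathbb{A}/\kappa\mathbb{A}\cong C_c^\infty(M)$, such that $\mathbb{A}/\kappa^3\mathbb{A}$ is a free $\mathbb{C}[\kappa]/\kappa^3$-module. * A Spin bundle: a smooth complex vector bundle $V\to M$ of finite positive rank with a smooth Clifford representation $c:T^*M\otimes\mathbb{C}\to\mathrm{End}(V)$, $c(\alpha)c(\beta)+c(\beta)c(\alpha)=2\langle\alpha,\beta\rangle$.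 * A bimodule deformation of $V$: an $\mathbb{A}$-bimodule $\mathbb{V}$ over $\Bbbk$ with an isomorphism of $C_c^\infty(M)$-bimodules $\mathbb{V}/\kappa\mathbb{V}\cong\Gamma_c(V)$ (left and right multiplication on $\Gamma_c(V)$ being equal), such that $\mathbb{V}/\kappa^3\mathbb{V}$ is a free $\mathbb{C}[\kappa]/\kappa^3$-module. * A $\Bbbk$-linear operator $D:\mathbb{V}\to\mathbb{V}$ such that: 1. $D_0:=D\bmod\kappa$ is a Dirac-type operator on $\Gamma_c(V)$, i.e. $[D_0,f]=i\,c(df)$ for all $f\in C_c^\infty(M)$; 2. for every $a\in\mathbb{A}$ the commutator $[D,a]$ commutes with right multiplication by elements of $\mathbb{A}$; 3. the noncommutative $1$-forms are a deformation of $1$-forms. That is, let $\Omega^1_D\subset\mathrm{End}_\Bbbk(\mathbb{V})$ be the $\mathbb{A}$-bimodule generated by all $[D,a]$, and put $da:=-i[D,a]$; then $\Omega^1_D/\kappa^3\Omega^1_D$ is a free $\mathbb{C}[\kappa]/\kappa^3$-module and there is an isomorphism of $C_c^\infty(M)$-bimodules $\Omega^1_D/\kappa\Omega^1_D\cong\Omega^1_c(M)$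 under which $d$ reduces modulo $\kappa$ to the gradient $f\mapsto df$. **Poisson structure and Koszul bracket.** The Poisson structure of the deformation is the smooth (complex) bivector field $\pi$ whose bracket $\{f,h\}=\pi(df,dh)$ satisfies $\kappa\{f,h\}=i(ab-ba)\bmod\kappa^2$ whenever $f=a\bmod\kappa$, $h=b\bmod\kappa$. This bracket satisfies the Jacobi identity. Let $\#\sigma$ denote the vector field with $\#\sigma(h)=\pi(\sigma,dh)$. The Koszul bracket is the bilinear alternating bracket on $\Omega^1_c(M)$ with $[df,dh]_\pi=d\{f,h\}$ and $[\sigma,f\rho]_\pi=\#\sigma(f)\,\rho+f[\sigma,\rho]_\pi$. **Contravariant connections.** A contravariant connection on $T^*M$ is a $\mathbb{C}$-bilinear map $(\sigma,\rho)\mapsto\mathcal{D}_\sigma\rho$ on $\Omega^1_c(M)$ with $\mathcal{D}_{f\sigma}\rho=f\mathcal{D}_\sigma\rho$ and $\mathcal{D}_\sigma(f\rho)=\#\sigma(f)\rho+f\mathcal{D}_\sigma\rho$. The metric contravariant connection of $(g,\pi)$ is the unique contravariant connection that is torsion-free, $\mathcal{D}_\sigma\rho-\mathcal{D}_\rho\sigma=[\sigma,\rho]_\pi$,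 and metric-compatible, $\#\sigma\langle\beta,\gamma\rangle=\langle\mathcal{D}_\sigma\beta,\gamma\rangle+\langle\beta,\mathcal{D}_\sigma\gamma\rangle$. **Claim.** If $(M,g)$ admits a deformed spectral triple, then its Poisson structure $\pi$, the Koszul bracket $[\cdot,\cdot]_\pi$ and the metric contravariant connection $\mathcal{D}$ of $(g,\pi)$ exist and are unique, and $\mathcal{D}$ is flat: $$K(\sigma,\rho)\tau:=\mathcal{D}_\sigma\mathcal{D}_\rho\tau-\mathcal{D}_\rho\mathcal{D}_\sigma\tau-\mathcal{D}_{[\sigma,\rho]_\pi}\tau=0\qquad\text{for all }\sigma,\rho,\tau\in\Omega^1_c(M).$$ -/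

import Mathlib

open scoped Manifold ContDiff Bundle Polynomial
open Bundle

noncomputable section

namespace DeformedGeometry

/-! ### Preliminaries: smoothness of products, sums and differentials -/

section Smoothness

variable {n : ℕ} {M : Type*} [TopologicalSpace M] [ChartedSpace (EuclideanSpace ℝ (Fin n)) M]

theorem contMDiff_mul_complex {f g : M → ℂ} (hf : ContMDiff (𝓡 n) 𝓘(ℝ, ℂ) ∞ f)
    (hg : ContMDiff (𝓡 n) 𝓘(ℝ, ℂ) ∞ g) : ContMDiff (𝓡 n) 𝓘(ℝ, ℂ) ∞ (f * g) :=
  (contDiff_mul (𝕜 := ℝ) (𝔸 := ℂ)).contMDiff.comp (hf.prodMk_space hg)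

theorem contMDiff_smul_section {F : Type*} [NormedAddCommGroup F] [NormedSpace ℂ F]
    {V : M → Type*} [TopologicalSpace (TotalSpace F V)] [∀ x, AddCommGroup (V x)]
    [∀ x, Module ℂ (V x)] [∀ x, TopologicalSpace (V x)] [FiberBundle F V] [VectorBundle ℂ F V]
    {f : M → ℂ} {s : ∀ x, V x} (hf : ContMDiff (𝓡 n) 𝓘(ℝ, ℂ) ∞ f)
    (hs : ContMDiff (𝓡 n) ((𝓡 n).prod 𝓘(ℝ, F)) ∞ (fun x => TotalSpace.mk' F x (s x))) :
    ContMDiff (𝓡 n) ((𝓡 n).prod 𝓘(ℝ, F)) ∞ (fun x => TotalSpace.mk' F x (f x • s x)) := by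
  intro x₀
  have h := hs x₀
  rw [Bundle.contMDiffAt_section] at h ⊢
  set e := trivializationAt F V x₀
  have h2 : ContMDiffAt (𝓡 n) 𝓘(ℝ, F) ∞ (fun x => f x • (e ⟨x, s x⟩).2) x₀ :=
    (contDiff_smul (𝕜 := ℝ) (𝕜' := ℂ) (F := F) (n := ∞)).contMDiff.contMDiffAt.comp x₀
      ((hf x₀).prodMk_space h)
  refine h2.congr_of_eventuallyEq ?_
  filter_upwards [e.open_baseSet.mem_nhds
    (FiberBundle.mem_baseSet_trivializationAt F V x₀)] with x hx
  exact (e.linear ℂ hx).2 (f x) (s x)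

theorem contMDiff_add_section {F : Type*} [NormedAddCommGroup F] [NormedSpace ℂ F]
    {V : M → Type*} [TopologicalSpace (TotalSpace F V)] [∀ x, AddCommGroup (V x)]
    [∀ x, Module ℂ (V x)] [∀ x, TopologicalSpace (V x)] [FiberBundle F V] [VectorBundle ℂ F V]
    {s t : ∀ x, V x}
    (hs : ContMDiff (𝓡 n) ((𝓡 n).prod 𝓘(ℝ, F)) ∞ (fun x => TotalSpace.mk' F x (s x)))
    (ht : ContMDiff (𝓡 n) ((𝓡 n).prod 𝓘(ℝ, F)) ∞ (fun x => TotalSpace.mk' F x (t x))) :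
    ContMDiff (𝓡 n) ((𝓡 n).prod 𝓘(ℝ, F)) ∞ (fun x => TotalSpace.mk' F x (s x + t x)) := by
  intro x₀
  have h := hs x₀
  have h' := ht x₀
  rw [Bundle.contMDiffAt_section] at h h' ⊢
  set e := trivializationAt F V x₀
  refine (h.add h').congr_of_eventuallyEq ?_
  filter_upwards [e.open_baseSet.mem_nhds
    (FiberBundle.mem_baseSet_trivializationAt F V x₀)] with x hx
  exact (e.linear ℂ hx).1 (s x) (t x)

theorem contMDiff_zero_section {F : Type*} [NormedAddCommGroup F] [NormedSpace ℂ F]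
    {V : M → Type*} [TopologicalSpace (TotalSpace F V)] [∀ x, AddCommGroup (V x)]
    [∀ x, Module ℂ (V x)] [∀ x, TopologicalSpace (V x)] [FiberBundle F V]
    [VectorBundle ℂ F V] :
    ContMDiff (𝓡 n) ((𝓡 n).prod 𝓘(ℝ, F)) ∞ (fun x => TotalSpace.mk' F x (0 : V x)) := by
  intro x₀
  rw [Bundle.contMDiffAt_section]
  set e := trivializationAt F V x₀
  refine (contMDiffAt_const (c := (0 : F))).congr_of_eventuallyEq ?_
  filter_upwards [e.open_baseSet.mem_nhds
    (FiberBundle.mem_baseSet_trivializationAt F V x₀)] with x hx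
  exact (e.linear ℂ hx).map_zero

theorem mvfderiv_eq_zero_of_notMem {f : M → ℂ} {x : M} (hx : x ∉ tsupport f) :
    mvfderiv (𝓡 n) f x = 0 := by
  have h : f =ᶠ[nhds x] (fun _ => (0 : ℂ)) := notMem_tsupport_iff_eventuallyEq.1 hx
  have h2 : mfderiv (𝓡 n) 𝓘(ℝ, ℂ) f x = 0 := by
    rw [h.mfderiv_eq, mfderiv_const]
    rfl
  rw [mvfderiv, h2]
  exact ContinuousLinearMap.comp_zero _

variable [IsManifold (𝓡 n) ∞ M]

theorem contMDiff_smul_form {f : M → ℂ} {s : ∀ x : M, TangentSpace (𝓡 n) x →L[ℝ] ℂ}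
    (hf : ContMDiff (𝓡 n) 𝓘(ℝ, ℂ) ∞ f)
    (hs : ContMDiff (𝓡 n) ((𝓡 n).prod 𝓘(ℝ, EuclideanSpace ℝ (Fin n) →L[ℝ] ℂ)) ∞
      (fun x => TotalSpace.mk' (EuclideanSpace ℝ (Fin n) →L[ℝ] ℂ) x (s x))) :
    ContMDiff (𝓡 n) ((𝓡 n).prod 𝓘(ℝ, EuclideanSpace ℝ (Fin n) →L[ℝ] ℂ)) ∞
      (fun x => TotalSpace.mk' (EuclideanSpace ℝ (Fin n) →L[ℝ] ℂ) x (f x • s x)) := by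
  intro x₀
  have h := hs x₀
  rw [contMDiffAt_hom_bundle] at h ⊢
  refine ⟨contMDiffAt_id, ?_⟩
  have h3 := (contDiff_smul (𝕜 := ℝ) (𝕜' := ℂ) (F := EuclideanSpace ℝ (Fin n) →L[ℝ] ℂ)
    (n := ∞)).contMDiff.contMDiffAt.comp x₀ ((hf x₀).prodMk_space h.2)
  refine h3.congr_of_eventuallyEq (Filter.Eventually.of_forall fun x => ?_)
  ext v
  simp [ContinuousLinearMap.inCoordinates]

theorem contMDiff_add_form {s t : ∀ x : M, TangentSpace (𝓡 n) x →L[ℝ] ℂ}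
    (hs : ContMDiff (𝓡 n) ((𝓡 n).prod 𝓘(ℝ, EuclideanSpace ℝ (Fin n) →L[ℝ] ℂ)) ∞
      (fun x => TotalSpace.mk' (EuclideanSpace ℝ (Fin n) →L[ℝ] ℂ) x (s x)))
    (ht : ContMDiff (𝓡 n) ((𝓡 n).prod 𝓘(ℝ, EuclideanSpace ℝ (Fin n) →L[ℝ] ℂ)) ∞
      (fun x => TotalSpace.mk' (EuclideanSpace ℝ (Fin n) →L[ℝ] ℂ) x (t x))) :
    ContMDiff (𝓡 n) ((𝓡 n).prod 𝓘(ℝ, EuclideanSpace ℝ (Fin n) →L[ℝ] ℂ)) ∞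
      (fun x => TotalSpace.mk' (EuclideanSpace ℝ (Fin n) →L[ℝ] ℂ) x (s x + t x)) := by
  intro x₀
  have h := hs x₀
  have h' := ht x₀
  rw [contMDiffAt_hom_bundle] at h h' ⊢
  refine ⟨contMDiffAt_id, ?_⟩
  refine (h.2.add h'.2).congr_of_eventuallyEq (Filter.Eventually.of_forall fun x => ?_)
  ext v
  simp [ContinuousLinearMap.inCoordinates]

theorem contMDiff_zero_form :
    ContMDiff (𝓡 n) ((𝓡 n).prod 𝓘(ℝ, EuclideanSpace ℝ (Fin n) →L[ℝ] ℂ)) ∞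
      (fun x : M => TotalSpace.mk' (E := fun x : M => TangentSpace (𝓡 n) x →L[ℝ] ℂ)
        (EuclideanSpace ℝ (Fin n) →L[ℝ] ℂ) x 0) := by
  intro x₀
  rw [contMDiffAt_hom_bundle]
  refine ⟨contMDiffAt_id, ?_⟩
  refine (contMDiffAt_const (c := (0 : EuclideanSpace ℝ (Fin n) →L[ℝ] ℂ))).congr_of_eventuallyEq
    (Filter.Eventually.of_forall fun x => ?_)
  ext v
  simp [ContinuousLinearMap.inCoordinates]

theorem contMDiff_mvfderiv {f : M → ℂ} (hf : ContMDiff (𝓡 n) 𝓘(ℝ, ℂ) ∞ f) :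
    ContMDiff (𝓡 n) ((𝓡 n).prod 𝓘(ℝ, EuclideanSpace ℝ (Fin n) →L[ℝ] ℂ)) ∞
      (fun x => TotalSpace.mk' (E := fun x : M => TangentSpace (𝓡 n) x →L[ℝ] ℂ)
        (EuclideanSpace ℝ (Fin n) →L[ℝ] ℂ) x (mvfderiv (𝓡 n) f x)) := by
  intro x₀
  rw [contMDiffAt_hom_bundle]
  refine ⟨contMDiffAt_id, ?_⟩
  have h3 := (hf x₀).mfderiv_const (m := ∞) (by simp)
  refine h3.congr_of_eventuallyEq (Filter.Eventually.of_forall fun x => ?_)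
  ext v
  simp [ContinuousLinearMap.inCoordinates, inTangentCoordinates, mvfderiv]
  rfl

end Smoothness

/-! ### Functions, `1`-forms and sections with compact support -/

section Classical

variable (n : ℕ) (M : Type*) [TopologicalSpace M] [ChartedSpace (EuclideanSpace ℝ (Fin n)) M]

/-- `C_c^∞(M)`: the (in general non-unital) algebra of smooth compactly supported complex valued
functions. -/
def SmoothFun : NonUnitalSubalgebra ℂ (M → ℂ) where
  carrier := {f | ContMDiff (𝓡 n) 𝓘(ℝ, ℂ) ∞ f ∧ HasCompactSupport f}
  zero_mem' := ⟨contMDiff_const, HasCompactSupport.zero⟩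
  add_mem' hf hg := ⟨hf.1.add hg.1, hf.2.add hg.2⟩
  mul_mem' hf hg := ⟨contMDiff_mul_complex hf.1 hg.1, hf.2.mul_right⟩
  smul_mem' c f hf := by
    refine ⟨contMDiff_mul_complex (f := fun _ => c) contMDiff_const hf.1, ?_⟩
    refine hf.2.mono' fun x hx => subset_tsupport _ fun h0 => hx ?_
    simp [h0]

variable {M} in
/-- Complex covectors at `x`, that is, elements of `T*ₓM ⊗ ℂ`. -/
abbrev Covector (x : M) : Type := TangentSpace (𝓡 n) x →L[ℝ] ℂ

/-- `Γ_c(M, V)`: smooth compactly supported sections of a complex vector bundle `V`. -/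
def Sections (F : Type*) [NormedAddCommGroup F] [NormedSpace ℂ F] {M : Type*}
    [TopologicalSpace M] [ChartedSpace (EuclideanSpace ℝ (Fin n)) M]
    (V : M → Type*) [TopologicalSpace (TotalSpace F V)] [∀ x, AddCommGroup (V x)]
    [∀ x, Module ℂ (V x)] [∀ x, TopologicalSpace (V x)] [FiberBundle F V] [VectorBundle ℂ F V] :
    Submodule ℂ (∀ x, V x) where
  carrier := {s | ContMDiff (𝓡 n) ((𝓡 n).prod 𝓘(ℝ, F)) ∞ (fun x => TotalSpace.mk' F x (s x)) ∧
    IsCompact (closure {x | s x ≠ 0})}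
  zero_mem' := ⟨contMDiff_zero_section, by simp⟩
  add_mem' {s t} hs ht := by
    refine ⟨contMDiff_add_section hs.1 ht.1, (hs.2.union ht.2).of_isClosed_subset
      isClosed_closure ?_⟩
    rw [← closure_union]
    refine closure_mono fun x hx => ?_
    by_contra h
    simp only [Set.mem_union, Set.mem_ofPred_eq, not_or, not_not] at h
    exact hx (by simp [h.1, h.2])
  smul_mem' c s hs := by
    refine ⟨contMDiff_smul_section (f := fun _ => c) contMDiff_const hs.1,
      hs.2.of_isClosed_subset isClosed_closure (closure_mono fun x hx h0 => hx ?_)⟩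
    simp [h0]

variable {M} in
/-- Pointwise multiplication of a section by a function. -/
instance {F : Type*} [NormedAddCommGroup F] [NormedSpace ℂ F]
    {V : M → Type*} [TopologicalSpace (TotalSpace F V)] [∀ x, AddCommGroup (V x)]
    [∀ x, Module ℂ (V x)] [∀ x, TopologicalSpace (V x)] [FiberBundle F V] [VectorBundle ℂ F V] :
    SMul (SmoothFun n M) (Sections n F V) where
  smul f s := ⟨fun x => (f : M → ℂ) x • (s : ∀ x, V x) x,
    contMDiff_smul_section f.2.1 s.2.1,
    s.2.2.of_isClosed_subset isClosed_closure (closure_mono fun x hx h0 => hx (by simp [h0]))⟩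

variable [IsManifold (𝓡 n) ∞ M]

/-- `Ω_c¹(M)`: smooth complex `1`-forms with compact support. -/
def OneForm : Submodule ℂ (∀ x : M, Covector n x) where
  carrier := {σ | ContMDiff (𝓡 n) ((𝓡 n).prod 𝓘(ℝ, EuclideanSpace ℝ (Fin n) →L[ℝ] ℂ)) ∞
      (fun x => TotalSpace.mk' (EuclideanSpace ℝ (Fin n) →L[ℝ] ℂ) x (σ x)) ∧
    IsCompact (closure {x | σ x ≠ 0})}
  zero_mem' := ⟨contMDiff_zero_form, by simp⟩
  add_mem' {s t} hs ht := by
    refine ⟨contMDiff_add_form hs.1 ht.1, (hs.2.union ht.2).of_isClosed_subset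
      isClosed_closure ?_⟩
    rw [← closure_union]
    refine closure_mono fun x hx => ?_
    by_contra h
    simp only [Set.mem_union, Set.mem_ofPred_eq, not_or, not_not] at h
    exact hx (by simp [h.1, h.2])
  smul_mem' c s hs := by
    refine ⟨contMDiff_smul_form (f := fun _ => c) contMDiff_const hs.1,
      hs.2.of_isClosed_subset isClosed_closure (closure_mono fun x hx h0 => hx ?_)⟩
    simp [h0]

variable {n M}

/-- Pointwise multiplication of a `1`-form by a function. -/
instance : SMul (SmoothFun n M) (OneForm n M) where
  smul f s := ⟨fun x => (f : M → ℂ) x • (s : ∀ x : M, Covector n x) x,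
    contMDiff_smul_form f.2.1 s.2.1,
    s.2.2.of_isClosed_subset isClosed_closure (closure_mono fun x hx h0 => hx (by
      change _ • (s : ∀ x : M, Covector n x) x = 0
      rw [h0]
      ext v
      exact mul_zero _))⟩

/-- The differential `df` of a smooth compactly supported function. -/
def gradient (f : SmoothFun n M) : OneForm n M :=
  ⟨fun x => mvfderiv (𝓡 n) (f : M → ℂ) x, contMDiff_mvfderiv f.2.1,
    f.2.2.isCompact.of_isClosed_subset isClosed_closure
      (closure_minimal (fun _ hx => by
        by_contra h
        exact hx (mvfderiv_eq_zero_of_notMem h)) (isClosed_tsupport _))⟩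

end Classical

/-! ### Pseudo-Riemannian metrics -/

section Metric

/-- A smooth pseudo-Riemannian metric: a smooth field of nondegenerate symmetric bilinear forms on
the tangent spaces. -/
structure PseudoRiemannianMetric (n : ℕ) (M : Type*) [TopologicalSpace M]
    [ChartedSpace (EuclideanSpace ℝ (Fin n)) M] [IsManifold (𝓡 n) ∞ M] where
  inner (x : M) : TangentSpace (𝓡 n) x →L[ℝ] TangentSpace (𝓡 n) x →L[ℝ] ℝ
  symm (x : M) (v w : TangentSpace (𝓡 n) x) : inner x v w = inner x w v
  nondegenerate (x : M) (v : TangentSpace (𝓡 n) x) (hv : ∀ w, inner x v w = 0) : v = 0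
  contMDiff : ContMDiff (𝓡 n) ((𝓡 n).prod 𝓘(ℝ, EuclideanSpace ℝ (Fin n) →L[ℝ]
      EuclideanSpace ℝ (Fin n) →L[ℝ] ℝ)) ∞
    (fun x => TotalSpace.mk' (EuclideanSpace ℝ (Fin n) →L[ℝ] EuclideanSpace ℝ (Fin n) →L[ℝ] ℝ) x
      (inner x))

variable {n : ℕ} {M : Type*} [TopologicalSpace M] [ChartedSpace (EuclideanSpace ℝ (Fin n)) M]
  [IsManifold (𝓡 n) ∞ M]

namespace PseudoRiemannianMetric

variable (g : PseudoRiemannianMetric n M)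

instance (x : M) : FiniteDimensional ℝ (TangentSpace (𝓡 n) x) :=
  inferInstanceAs (FiniteDimensional ℝ (EuclideanSpace ℝ (Fin n)))

/-- The isomorphism `TₓM ≃ T*ₓM`, `v ↦ g(v, ·)`. -/
def lower (x : M) : TangentSpace (𝓡 n) x ≃ₗ[ℝ] (TangentSpace (𝓡 n) x →L[ℝ] ℝ) :=
  LinearEquiv.ofInjectiveOfFinrankEq (g.inner x : TangentSpace (𝓡 n) x →ₗ[ℝ] _)
    (by
      refine (injective_iff_map_eq_zero _).2 fun v hv => g.nondegenerate x v fun w => ?_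
      exact congrArg (fun (φ : TangentSpace (𝓡 n) x →L[ℝ] ℝ) => φ w) hv)
    (by
      have : T2Space (TangentSpace (𝓡 n) x) :=
        inferInstanceAs (T2Space (EuclideanSpace ℝ (Fin n)))
      rw [← LinearEquiv.finrank_eq (LinearMap.toContinuousLinearMap
        (𝕜 := ℝ) (E := TangentSpace (𝓡 n) x) (F' := ℝ))]
      exact Subspace.dual_finrank_eq.symm)

/-- The pairing `⟨α, β⟩ = g^{ij} α_i β_j` of covectors, extended to complex covectors by
`ℂ`-bilinearity: with `β = β₁ + i β₂` one has `⟨α, β⟩ = α(♯β₁) + i α(♯β₂)`, where `♯` is the inverse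
of `v ↦ g(v, ·)`. -/
def pairing (x : M) (α β : Covector n x) : ℂ :=
  α ((g.lower x).symm (Complex.reCLM ∘L β)) +
    Complex.I * α ((g.lower x).symm (Complex.imCLM ∘L β))

end PseudoRiemannianMetric

end Metric

/-! ### Poisson structures, the Koszul bracket and contravariant connections -/

section Poisson

/-- A smooth (complex) bivector field, viewed as a field of alternating bilinear forms on the
complex cotangent spaces. -/
structure BivectorField (n : ℕ) (M : Type*) [TopologicalSpace M]
    [ChartedSpace (EuclideanSpace ℝ (Fin n)) M] [IsManifold (𝓡 n) ∞ M] where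
  toFun (x : M) : Covector n x →ₗ[ℂ] Covector n x →ₗ[ℂ] ℂ
  alternating (x : M) (α : Covector n x) : toFun x α α = 0
  smooth (σ ρ : OneForm n M) : ContMDiff (𝓡 n) 𝓘(ℝ, ℂ) ∞
    (fun x => toFun x ((σ : ∀ x : M, Covector n x) x) ((ρ : ∀ x : M, Covector n x) x))

variable {n : ℕ} {M : Type*} [TopologicalSpace M] [ChartedSpace (EuclideanSpace ℝ (Fin n)) M]
  [IsManifold (𝓡 n) ∞ M]

namespace BivectorField

variable (P : BivectorField n M)

/-- The function `P(σ, ρ)`. -/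
def pair (σ ρ : OneForm n M) : SmoothFun n M :=
  ⟨fun x => P.toFun x ((σ : ∀ x : M, Covector n x) x) ((ρ : ∀ x : M, Covector n x) x),
    P.smooth σ ρ, σ.2.2.of_isClosed_subset (isClosed_tsupport _)
      (closure_mono fun x hx h0 => hx (by simp [h0]))⟩

/-- The bracket `{f, h} = P(df, dh)`. -/
def bracket (f h : SmoothFun n M) : SmoothFun n M := P.pair (gradient f) (gradient h)

/-- The directional derivative `#σ(h) = P(σ, dh)` of a function along `#σ`, where
`(#σ)^j = P^{ij} σ_i`. -/
def sharpDeriv (σ : OneForm n M) (h : SmoothFun n M) : SmoothFun n M := P.pair σ (gradient h)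

end BivectorField

/-- A Poisson structure: a bivector field whose bracket satisfies the Jacobi identity. -/
structure PoissonStructure (n : ℕ) (M : Type*) [TopologicalSpace M]
    [ChartedSpace (EuclideanSpace ℝ (Fin n)) M] [IsManifold (𝓡 n) ∞ M] extends
    BivectorField n M where
  jacobi (f g h : SmoothFun n M) :
    toBivectorField.bracket f (toBivectorField.bracket g h) +
      toBivectorField.bracket g (toBivectorField.bracket h f) +
      toBivectorField.bracket h (toBivectorField.bracket f g) = 0

/-- `B` is the Koszul bracket `[·,·]_P` of `1`-forms: the `ℂ`-bilinear alternating bracket with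
`[df, dh]_P = d{f, h}` and `[σ, f ρ]_P = #σ(f) ρ + f [σ, ρ]_P`. -/
structure PoissonStructure.IsKoszulBracket (P : PoissonStructure n M)
    (B : OneForm n M →ₗ[ℂ] OneForm n M →ₗ[ℂ] OneForm n M) : Prop where
  alternating (σ : OneForm n M) : B σ σ = 0
  gradient (f h : SmoothFun n M) : B (gradient f) (gradient h) = gradient (P.bracket f h)
  leibniz (σ ρ : OneForm n M) (f : SmoothFun n M) :
    B σ (f • ρ) = P.sharpDeriv σ f • ρ + f • B σ ρ

/-- A contravariant connection on the (complexified) cotangent bundle of a Poisson manifold. -/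
structure ContravariantConnection (P : PoissonStructure n M) where
  toFun : OneForm n M →ₗ[ℂ] OneForm n M →ₗ[ℂ] OneForm n M
  smul_left (f : SmoothFun n M) (σ ρ : OneForm n M) : toFun (f • σ) ρ = f • toFun σ ρ
  leibniz (σ : OneForm n M) (f : SmoothFun n M) (ρ : OneForm n M) :
    toFun σ (f • ρ) = P.sharpDeriv σ f • ρ + f • toFun σ ρ

namespace ContravariantConnection

variable {P : PoissonStructure n M} (B : OneForm n M →ₗ[ℂ] OneForm n M →ₗ[ℂ] OneForm n M)
  (𝒟 : ContravariantConnection P)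

/-- The torsion `T(σ, ρ) = 𝒟_σ ρ - 𝒟_ρ σ - [σ, ρ]_P`; here `B` is the Koszul bracket. -/
def torsion (σ ρ : OneForm n M) : OneForm n M := 𝒟.toFun σ ρ - 𝒟.toFun ρ σ - B σ ρ

/-- The curvature `K(σ, ρ) τ = 𝒟_σ 𝒟_ρ τ - 𝒟_ρ 𝒟_σ τ - 𝒟_{[σ, ρ]_P} τ`; here `B` is the Koszul
bracket. -/
def curvature (σ ρ τ : OneForm n M) : OneForm n M :=
  𝒟.toFun σ (𝒟.toFun ρ τ) - 𝒟.toFun ρ (𝒟.toFun σ τ) - 𝒟.toFun (B σ ρ) τ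

/-- Flatness: the curvature vanishes. -/
def IsFlat : Prop := ∀ σ ρ τ : OneForm n M, 𝒟.curvature B σ ρ τ = 0

/-- Compatibility with the metric: `#σ ⟨β, γ⟩ = ⟨𝒟_σ β, γ⟩ + ⟨β, 𝒟_σ γ⟩`. -/
def IsMetricCompatible (g : PseudoRiemannianMetric n M) : Prop :=
  ∀ (σ β γ : OneForm n M) (x : M),
    P.toFun x ((σ : ∀ x : M, Covector n x) x)
        (mvfderiv (𝓡 n) (fun y => g.pairing y ((β : ∀ x : M, Covector n x) y)
          ((γ : ∀ x : M, Covector n x) y)) x) =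
      g.pairing x ((𝒟.toFun σ β : ∀ x : M, Covector n x) x) ((γ : ∀ x : M, Covector n x) x) +
        g.pairing x ((β : ∀ x : M, Covector n x) x) ((𝒟.toFun σ γ : ∀ x : M, Covector n x) x)

/-- `𝒟` is the metric contravariant connection of `(g, P)`, the torsion-free metric-compatible
contravariant connection; `B` is the Koszul bracket of `P`. -/
structure IsMetricConnection (g : PseudoRiemannianMetric n M) : Prop where
  torsion_free (σ ρ : OneForm n M) : 𝒟.torsion B σ ρ = 0
  metric_compatible : 𝒟.IsMetricCompatible g

end ContravariantConnection

end Poisson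

/-! ### Bimodules and noncommutative `1`-forms -/

section NCForms

/-- An `𝔸`-bimodule structure on the `𝕜`-module `W`. -/
structure Bimodule (𝕜 𝔸 W : Type*) [CommRing 𝕜] [NonUnitalRing 𝔸] [Module 𝕜 𝔸]
    [AddCommGroup W] [Module 𝕜 W] where
  /-- `left a w = a w` -/
  left : 𝔸 →ₗ[𝕜] W →ₗ[𝕜] W
  /-- `right a w = w a` -/
  right : 𝔸 →ₗ[𝕜] W →ₗ[𝕜] W
  left_mul (a b : 𝔸) (w : W) : left (a * b) w = left a (left b w)
  right_mul (a b : 𝔸) (w : W) : right (a * b) w = right b (right a w)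
  left_right (a b : 𝔸) (w : W) : left a (right b w) = right b (left a w)


variable {𝕜 𝔸 𝕍 : Type*} [CommRing 𝕜] [NonUnitalRing 𝔸] [Module 𝕜 𝔸] [AddCommGroup 𝕍] [Module 𝕜 𝕍]

/-- The commutator `[D, a] = D a - a D` of `D` with the left multiplication by `a`. -/
def Bimodule.commutator (bimod : Bimodule 𝕜 𝔸 𝕍) (D : Module.End 𝕜 𝕍) (a : 𝔸) :
    Module.End 𝕜 𝕍 := D * bimod.left a - bimod.left a * D

/-- `Ω¹_D`: the sub-bimodule of `End(𝕍)` generated by the commutators `[D, a]`, that is, the smallest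
`𝕜`-submodule that contains them and is stable under composition with multiplications `b·` on either
side. -/
def Bimodule.ncForms (bimod : Bimodule 𝕜 𝔸 𝕍) (D : Module.End 𝕜 𝕍) :
    Submodule 𝕜 (Module.End 𝕜 𝕍) :=
  sInf {S | (∀ a, bimod.commutator D a ∈ S) ∧
    (∀ (b : 𝔸), ∀ T ∈ S, bimod.left b * T ∈ S) ∧ (∀ (b : 𝔸), ∀ T ∈ S, T * bimod.left b ∈ S)}

variable (bimod : Bimodule 𝕜 𝔸 𝕍) (D : Module.End 𝕜 𝕍)

theorem Bimodule.commutator_mem (a : 𝔸) : bimod.commutator D a ∈ bimod.ncForms D := by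
  simp only [Bimodule.ncForms, Submodule.mem_sInf]
  exact fun S hS => hS.1 a

theorem Bimodule.left_mul_mem (b : 𝔸) {T : Module.End 𝕜 𝕍} (hT : T ∈ bimod.ncForms D) :
    bimod.left b * T ∈ bimod.ncForms D := by
  simp only [Bimodule.ncForms, Submodule.mem_sInf] at hT ⊢
  exact fun S hS => hS.2.1 b T (hT S hS)

theorem Bimodule.mul_left_mem (b : 𝔸) {T : Module.End 𝕜 𝕍} (hT : T ∈ bimod.ncForms D) :
    T * bimod.left b ∈ bimod.ncForms D := by
  simp only [Bimodule.ncForms, Submodule.mem_sInf] at hT ⊢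
  exact fun S hS => hS.2.2 b T (hT S hS)

/-- The `𝔸`-bimodule structure of `Ω¹_D`, by composition of operators. -/
def Bimodule.ncFormsBimodule : Bimodule 𝕜 𝔸 (bimod.ncForms D) where
  left := LinearMap.mk₂ 𝕜
    (fun b T => ⟨bimod.left b * (T : Module.End 𝕜 𝕍), bimod.left_mul_mem D b T.2⟩)
    (by intros; ext; simp) (by intros; ext; simp) (by intros; ext; simp) (by intros; ext; simp)
  right := LinearMap.mk₂ 𝕜
    (fun b T => ⟨(T : Module.End 𝕜 𝕍) * bimod.left b, bimod.mul_left_mem D b T.2⟩)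
    (by intros; ext; simp) (by intros; ext; simp) (by intros; ext; simp) (by intros; ext; simp)
  left_mul a b T := by ext; simp [bimod.left_mul]
  right_mul a b T := by ext; simp [bimod.left_mul]
  left_right a b T := by ext; simp

variable [Algebra ℂ 𝕜] [Module ℂ 𝕍] [IsScalarTower ℂ 𝕜 𝕍]

/-- The differential `da = -i [D, a]` with values in `Ω¹_D`. -/
def Bimodule.ncDiff (a : 𝔸) : bimod.ncForms D :=
  (-Complex.I) • ⟨bimod.commutator D a, bimod.commutator_mem D a⟩

end NCForms

/-! ### Smooth deformations -/

section Deformation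

/-- The homomorphism `ℂ[X]/X³ → 𝕜/κ³𝕜`, `X ↦ κ`. -/
def truncatedEval {𝕜 : Type*} [CommRing 𝕜] [Algebra ℂ 𝕜] (κ : 𝕜) :
    (ℂ[X] ⧸ Ideal.span {(Polynomial.X : ℂ[X]) ^ 3}) →+* 𝕜 ⧸ Ideal.span {κ ^ 3} :=
  Ideal.quotientMap (Ideal.span {κ ^ 3}) (Polynomial.aeval (R := ℂ) κ : ℂ[X] →ₐ[ℂ] 𝕜).toRingHom
    (by
      rw [Ideal.span_le, Set.singleton_subset_iff]
      simp)

/-- The `ℂ[κ]/κ³`-module structure of `W / κ³W`. -/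
abbrev truncatedModule {𝕜 : Type*} [CommRing 𝕜] [Algebra ℂ 𝕜] (κ : 𝕜) (W : Type*)
    [AddCommGroup W] [Module 𝕜 W] :
    Module (ℂ[X] ⧸ Ideal.span {(Polynomial.X : ℂ[X]) ^ 3})
      (W ⧸ Ideal.span {κ ^ 3} • (⊤ : Submodule 𝕜 W)) :=
  Module.compHom _ (truncatedEval κ)

/-- `W / κ³W` is a free module over `ℂ[κ]/κ³`. -/
def IsFreeToSecondOrder {𝕜 : Type*} [CommRing 𝕜] [Algebra ℂ 𝕜] (κ : 𝕜) (W : Type*)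
    [AddCommGroup W] [Module 𝕜 W] : Prop :=
  @Module.Free (ℂ[X] ⧸ Ideal.span {(Polynomial.X : ℂ[X]) ^ 3})
    (W ⧸ Ideal.span {κ ^ 3} • (⊤ : Submodule 𝕜 W)) _ _ (truncatedModule κ W)

/-- A smooth deformation (to second order) of `M`: a (not necessarily unital) associative
`𝕜`-algebra `𝔸`, an element `κ : 𝕜`, and an isomorphism `𝔸/κ𝔸 ≅ C_c^∞(M)` of `ℂ`-algebras, given as
a surjective homomorphism `𝔸 → C_c^∞(M)` with kernel `κ𝔸`, such that `𝔸/κ³𝔸` is a free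
`ℂ[κ]/κ³`-module. -/
structure SmoothDeformation (n : ℕ) (M : Type*) [TopologicalSpace M]
    [ChartedSpace (EuclideanSpace ℝ (Fin n)) M] (𝕜 𝔸 : Type*) [CommRing 𝕜] [Algebra ℂ 𝕜]
    [NonUnitalRing 𝔸] [Module ℂ 𝔸] [Module 𝕜 𝔸] [IsScalarTower ℂ 𝕜 𝔸] [IsScalarTower 𝕜 𝔸 𝔸]
    [SMulCommClass 𝕜 𝔸 𝔸] where
  κ : 𝕜
  proj : 𝔸 →ₙₐ[ℂ] SmoothFun n M
  proj_surjective : Function.Surjective proj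
  proj_eq_zero_iff (a : 𝔸) : proj a = 0 ↔ ∃ b : 𝔸, a = κ • b
  free : IsFreeToSecondOrder κ 𝔸

variable {n : ℕ} {M : Type*} [TopologicalSpace M] [ChartedSpace (EuclideanSpace ℝ (Fin n)) M]
  {𝕜 𝔸 : Type*} [CommRing 𝕜] [Algebra ℂ 𝕜]
  [NonUnitalRing 𝔸] [Module ℂ 𝔸] [Module 𝕜 𝔸] [IsScalarTower ℂ 𝕜 𝔸] [IsScalarTower 𝕜 𝔸 𝔸]
  [SMulCommClass 𝕜 𝔸 𝔸]

/-- `p : W → N` exhibits the `𝔸`-bimodule `W` as a bimodule deformation of `N`, where `N` is the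
module of compactly supported sections of a vector bundle, with equal left and right multiplication
by functions: `p` induces an isomorphism `W/κW ≅ N` of `C_c^∞(M)`-bimodules, and `W/κ³W` is a free
`ℂ[κ]/κ³`-module. -/
structure IsBimoduleDeformation (A : SmoothDeformation n M 𝕜 𝔸) {W : Type*} [AddCommGroup W]
    [Module ℂ W] [Module 𝕜 W] (N : Type*) [AddCommGroup N] [Module ℂ N] [SMul (SmoothFun n M) N]
    (bimod : Bimodule 𝕜 𝔸 W) (p : W →ₗ[ℂ] N) : Prop where
  surjective : Function.Surjective p
  eq_zero_iff (w : W) : p w = 0 ↔ ∃ u : W, w = A.κ • u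
  map_left (a : 𝔸) (w : W) : p (bimod.left a w) = A.proj a • p w
  map_right (a : 𝔸) (w : W) : p (bimod.right a w) = A.proj a • p w
  free : IsFreeToSecondOrder A.κ W

/-- `P` is the Poisson structure of the deformation: `κ {f, h} = i [a, b] mod κ²` whenever
`f = a mod κ`, `h = b mod κ`. -/
def SmoothDeformation.IsPoissonStructure [IsManifold (𝓡 n) ∞ M] (A : SmoothDeformation n M 𝕜 𝔸)
    (P : PoissonStructure n M) : Prop :=
  ∀ a b c : 𝔸, A.proj c = P.bracket (A.proj a) (A.proj b) →
    ∃ d : 𝔸, A.κ • c = Complex.I • (a * b - b * a) + A.κ ^ 2 • d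

end Deformation

/-! ### Spin bundles, Dirac-type operators and deformed spectral triples -/

section SpectralTriple

variable {n : ℕ} {M : Type*} [TopologicalSpace M] [ChartedSpace (EuclideanSpace ℝ (Fin n)) M]
  [IsManifold (𝓡 n) ∞ M] (g : PseudoRiemannianMetric n M)
  (F : Type*) [NormedAddCommGroup F] [NormedSpace ℂ F]
  (V : M → Type*) [TopologicalSpace (TotalSpace F V)] [∀ x, AddCommGroup (V x)]
  [∀ x, Module ℂ (V x)] [∀ x, TopologicalSpace (V x)] [FiberBundle F V] [VectorBundle ℂ F V]

/-- A Clifford representation on the complex vector bundle `V` (making `V` a Spin bundle): a smooth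
family of linear maps `c : T*ₓM ⊗ ℂ → End(Vₓ)` with `c(α) c(β) + c(β) c(α) = 2 ⟨α, β⟩`. -/
structure CliffordRepresentation where
  toFun (x : M) : Covector n x →ₗ[ℂ] V x →ₗ[ℂ] V x
  clifford (x : M) (α β : Covector n x) (v : V x) :
    toFun x α (toFun x β v) + toFun x β (toFun x α v) = (2 * g.pairing x α β) • v
  smooth (σ : OneForm n M) (s : Sections n F V) :
    ContMDiff (𝓡 n) ((𝓡 n).prod 𝓘(ℝ, F)) ∞ (fun x => TotalSpace.mk' F x
      (toFun x ((σ : ∀ x : M, Covector n x) x) ((s : ∀ x, V x) x)))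

variable {g F V}

/-- The action `c(σ) s` of a `1`-form on a section. -/
def CliffordRepresentation.act (c : CliffordRepresentation g F V) (σ : OneForm n M)
    (s : Sections n F V) : Sections n F V :=
  ⟨fun x => c.toFun x ((σ : ∀ x : M, Covector n x) x) ((s : ∀ x, V x) x), c.smooth σ s,
    s.2.2.of_isClosed_subset isClosed_closure (closure_mono fun x hx h0 => hx (by simp [h0]))⟩

/-- `D₀` is a Dirac-type operator: `[D₀, f] = i c(df)` for all functions `f`, i.e. `D₀` is a first
order differential operator whose principal symbol is Clifford multiplication. -/
def CliffordRepresentation.IsDiracType (c : CliffordRepresentation g F V)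
    (D₀ : Sections n F V →ₗ[ℂ] Sections n F V) : Prop :=
  ∀ (f : SmoothFun n M) (s : Sections n F V),
    D₀ (f • s) - f • D₀ s = Complex.I • c.act (gradient f) s

variable (g F V) in
/-- A deformed spectral triple `(𝔸, 𝕍, D)` for the pseudo-Riemannian manifold `(M, g)`, over the
complex vector bundle `V`. -/
structure DeformedSpectralTriple (𝕜 𝔸 𝕍 : Type*) [CommRing 𝕜] [Algebra ℂ 𝕜]
    [NonUnitalRing 𝔸] [Module ℂ 𝔸] [Module 𝕜 𝔸] [IsScalarTower ℂ 𝕜 𝔸] [IsScalarTower 𝕜 𝔸 𝔸]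
    [SMulCommClass 𝕜 𝔸 𝔸] [AddCommGroup 𝕍] [Module ℂ 𝕍] [Module 𝕜 𝕍] [IsScalarTower ℂ 𝕜 𝕍] where
  /-- the smooth deformation of `M` -/
  deformation : SmoothDeformation n M 𝕜 𝔸
  /-- the structure of a Spin bundle on `V` -/
  clifford : CliffordRepresentation g F V
  bimod : Bimodule 𝕜 𝔸 𝕍
  proj : 𝕍 →ₗ[ℂ] Sections n F V
  isBimoduleDeformation : IsBimoduleDeformation deformation (Sections n F V) bimod proj
  D : Module.End 𝕜 𝕍
  /-- `D mod κ` -/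
  D₀ : Sections n F V →ₗ[ℂ] Sections n F V
  proj_D (v : 𝕍) : proj (D v) = D₀ (proj v)
  isDiracType : clifford.IsDiracType D₀
  /-- `[D, a]` commutes with right multiplications -/
  commutator_right (a b : 𝔸) (v : 𝕍) :
    bimod.commutator D a (bimod.right b v) = bimod.right b (bimod.commutator D a v)
  /-- the noncommutative `1`-forms `Ω¹_D` are a deformation of `1`-forms: a bimodule deformation of
  the cotangent bundle such that `da = -i [D, a]` reduces to the gradient modulo `κ` -/
  formProj : bimod.ncForms D →ₗ[ℂ] OneForm n M
  isFormDeformation : IsBimoduleDeformation deformation (OneForm n M) (bimod.ncFormsBimodule D)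
    formProj
  formProj_ncDiff (a : 𝔸) : formProj (bimod.ncDiff D a) = gradient (deformation.proj a)

end SpectralTriple

end DeformedGeometry

end

noncomputable section

namespace DeformedGeometry

/-! ### Consequences of freeness to second order -/

section Freeness

/-! Write `[a, w] = a w - w a`. On a bimodule deformation `W` of `N` the two multiplications agree
modulo `κ`, so `i [a, w]` is divisible by `κ`, and the quotient modulo `κ` depends only on the
classes of `a` and `w`. This gives a bracket `{f, s}` of functions with elements of `N`
(`IsBimoduleDeformation.bracket`). Freeness over `ℂ[κ]/κ³` is what permits dividing by `κ` and by
`κ²`. Commutator identities descend to the bracket: it is a derivation in `f`, it obeys a Leibniz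
rule in `s`, and the Jacobi identity, read at order `κ²`, becomes `{f, {h, s}} - {h, {f, s}} = {{f,
h}, s}` (`bracket_bracket`).

For `W = 𝔸` this is the Poisson bracket. For `W = Ω¹_D` the value of `{f, ρ}` at a point depends on
`f` only through `df` there, so there is a contravariant connection with `𝒟_{df} ρ = {f, ρ}`. The
Jacobi identity says that its curvature vanishes on pairs of exact forms, and tensoriality extends
this to all forms.

It remains to recognise this as the metric connection. Since `d` is a derivation, `d(i[a, b]) = i[a,
db] - i[b, da]`, which gives vanishing torsion (`gradient_bracket`). For the metric, lift two forms
to operators `α, β` and `2⟨α, β⟩` to `b`. The operator `αβ + βα - b` vanishes modulo `κ` by the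
Clifford relation and commutes with right multiplications, so its commutator with any `a` vanishes
modulo `κ²`; at order `κ` this is metric compatibility (`bracket_pairing`). The metric connection is
unique (`IsMetricConnection.eq`), so it is the flat one just constructed.

Algebra and geometry meet in two facts: a point derivation of `C_c^∞(M)` factors through the
differential (`exists_linearMap_of_derivation`), and compactly supported forms are finite sums of
forms `f dh` (`OneForm.induction_gradient`). -/

theorem exists_smul_eq_of_free {R N : Type*} [CommRing R] [AddCommGroup N] [Module R N]
    [Module.Free R N] {x y : R} (hxy : ∀ c, y * c = 0 → ∃ d, c = x * d) {m : N}
    (hm : y • m = 0) : ∃ m', m = x • m' := by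
  -- Each coordinate of `m` is killed by `y`, hence is a multiple of `x`.
  let b := Module.Free.chooseBasis R N
  have h (i) : ∃ d, b.repr m i = x * d := by
    refine hxy _ ?_
    simpa using congrArg (fun z => b.repr z i) hm
  choose d hd using h
  refine ⟨∑ i ∈ (b.repr m).support, d i • b i, ?_⟩
  conv_lhs => rw [← b.linearCombination_repr m, Finsupp.linearCombination_apply, Finsupp.sum]
  rw [Finset.smul_sum]
  exact Finset.sum_congr rfl fun i _ => by rw [hd i, mul_smul]

variable {𝕜 : Type*} [CommRing 𝕜] [Algebra ℂ 𝕜] {κ : 𝕜} {W : Type*} [AddCommGroup W] [Module 𝕜 W]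

/-- In `ℂ[X]/X³` the annihilator of `X²` is generated by `X`, and freeness carries this over to
`W/κ³W`. Nothing is known about torsion in `W` beyond order `κ³`, hence the term `κ³ u`. -/
theorem IsFreeToSecondOrder.exists_eq_smul_of_sq_smul_eq (h : IsFreeToSecondOrder κ W) {w u : W}
    (hw : κ ^ 2 • w = κ ^ 3 • u) : ∃ v, w = κ • v := by
  let := truncatedModule κ W
  have : Module.Free (ℂ[X] ⧸ Ideal.span {(Polynomial.X : ℂ[X]) ^ 3})
    (W ⧸ Ideal.span {κ ^ 3} • (⊤ : Submodule 𝕜 W)) := h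
  let X' : ℂ[X] ⧸ Ideal.span {(Polynomial.X : ℂ[X]) ^ 3} := Ideal.Quotient.mk _ Polynomial.X
  have hX (k : ℕ) (z : W) : X' ^ k • (Submodule.Quotient.mk z :
      W ⧸ Ideal.span {κ ^ 3} • (⊤ : Submodule 𝕜 W)) = Submodule.Quotient.mk (κ ^ k • z) := by
    have : truncatedEval κ (X' ^ k) = Ideal.Quotient.mk _ (κ ^ k) := by
      rw [map_pow, map_pow]
      congr 1
      simp [truncatedEval, X']
    change truncatedEval κ (X' ^ k) • (Submodule.Quotient.mk z :
      W ⧸ Ideal.span {κ ^ 3} • (⊤ : Submodule 𝕜 W)) = _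
    rw [this]
    rfl
  have hmem (z : W) : z ∈ Ideal.span {κ ^ 3} • (⊤ : Submodule 𝕜 W) ↔ ∃ v, z = κ ^ 3 • v := by
    rw [Submodule.ideal_span_singleton_smul, Submodule.mem_smul_pointwise_iff_exists]
    simp [eq_comm]
  obtain ⟨m, hm⟩ := exists_smul_eq_of_free (x := X') (y := X' ^ 2)
    (m := (Submodule.Quotient.mk w : W ⧸ Ideal.span {κ ^ 3} • (⊤ : Submodule 𝕜 W))) (by
      intro c hc
      obtain ⟨p, rfl⟩ := Ideal.Quotient.mk_surjective c
      rw [← map_pow, ← map_mul, Ideal.Quotient.eq_zero_iff_mem, Ideal.mem_span_singleton,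
        pow_succ, mul_dvd_mul_iff_left (pow_ne_zero _ Polynomial.X_ne_zero)] at hc
      obtain ⟨d, rfl⟩ := hc
      exact ⟨Ideal.Quotient.mk _ d, map_mul _ _ _⟩) (by
      rw [hX, Submodule.Quotient.mk_eq_zero, hmem]
      exact ⟨u, hw⟩)
  obtain ⟨v, rfl⟩ := Submodule.Quotient.mk_surjective _ m
  have h1 := hX 1 v
  rw [pow_one, pow_one] at h1
  rw [h1, Submodule.Quotient.eq, hmem] at hm
  obtain ⟨r, hr⟩ := hm
  -- The quotient only yields `w - κ v = κ³ r`; the remainder is itself a multiple of `κ` and is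
  -- absorbed into the witness.
  refine ⟨v + κ ^ 2 • r, ?_⟩
  rw [smul_add, smul_smul, ← pow_succ', ← hr]
  abel

theorem IsFreeToSecondOrder.exists_eq_smul_of_smul_eq (h : IsFreeToSecondOrder κ W) {w u : W}
    (hw : κ • w = κ ^ 2 • u) : ∃ v, w = κ • v := by
  refine h.exists_eq_smul_of_sq_smul_eq (u := u) ?_
  rw [sq, mul_smul, hw, smul_smul, ← pow_succ']

end Freeness

/-! ### The bracket of a bimodule deformation -/

section Bracket

variable {n : ℕ} {M : Type*} [TopologicalSpace M] [ChartedSpace (EuclideanSpace ℝ (Fin n)) M]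
  {𝕜 𝔸 : Type*} [CommRing 𝕜] [Algebra ℂ 𝕜]
  [NonUnitalRing 𝔸] [Module ℂ 𝔸] [Module 𝕜 𝔸] [IsScalarTower ℂ 𝕜 𝔸] [IsScalarTower 𝕜 𝔸 𝔸]
  [SMulCommClass 𝕜 𝔸 𝔸]

/-- `ad a w = i (a w - w a)`. -/
def Bimodule.ad {W : Type*} [AddCommGroup W] [Module 𝕜 W] (bimod : Bimodule 𝕜 𝔸 W) :
    𝔸 →ₗ[𝕜] W →ₗ[𝕜] W :=
  algebraMap ℂ 𝕜 Complex.I • (bimod.left - bimod.right)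

omit [Module ℂ 𝔸] [IsScalarTower ℂ 𝕜 𝔸] [IsScalarTower 𝕜 𝔸 𝔸] [SMulCommClass 𝕜 𝔸 𝔸] in
theorem Bimodule.ad_apply {W : Type*} [AddCommGroup W] [Module 𝕜 W] (bimod : Bimodule 𝕜 𝔸 W)
    (a : 𝔸) (w : W) :
    bimod.ad a w = algebraMap ℂ 𝕜 Complex.I • (bimod.left a w - bimod.right a w) := rfl

variable (𝕜 𝔸) in
/-- The algebra `𝔸` as a bimodule over itself. -/
def selfBimodule : Bimodule 𝕜 𝔸 𝔸 where
  left := LinearMap.mul 𝕜 𝔸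
  right := (LinearMap.mul 𝕜 𝔸).flip
  left_mul a b w := by simp [mul_assoc]
  right_mul a b w := by simp [mul_assoc]
  left_right a b w := by simp [mul_assoc]

omit [Algebra ℂ 𝕜] [Module ℂ 𝔸] [IsScalarTower ℂ 𝕜 𝔸] in
theorem selfBimodule_left (a b : 𝔸) : (selfBimodule 𝕜 𝔸).left a b = a * b := rfl

omit [Algebra ℂ 𝕜] [Module ℂ 𝔸] [IsScalarTower ℂ 𝕜 𝔸] in
theorem selfBimodule_right (a b : 𝔸) : (selfBimodule 𝕜 𝔸).right a b = b * a := rfl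

variable {A : SmoothDeformation n M 𝕜 𝔸}

theorem SmoothDeformation.isBimoduleDeformation_self (A : SmoothDeformation n M 𝕜 𝔸) :
    IsBimoduleDeformation A (SmoothFun n M) (selfBimodule 𝕜 𝔸) (A.proj : 𝔸 →ₗ[ℂ] SmoothFun n M)
    where
  surjective := A.proj_surjective
  eq_zero_iff := A.proj_eq_zero_iff
  map_left a w := by
    rw [selfBimodule_left, smul_eq_mul]
    exact map_mul A.proj a w
  map_right a w := by
    rw [selfBimodule_right, smul_eq_mul, mul_comm]
    exact map_mul A.proj w a
  free := A.free

variable {W : Type*} [AddCommGroup W] [Module ℂ W] [Module 𝕜 W] {N : Type*} [AddCommGroup N]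
  [Module ℂ N] [SMul (SmoothFun n M) N] {bimod : Bimodule 𝕜 𝔸 W} {p : W →ₗ[ℂ] N}

namespace IsBimoduleDeformation

variable (hW : IsBimoduleDeformation A N bimod p)

include hW

/-- Division by `κ` becomes well defined after projecting to `N`, and an error of order `κ²` does no
harm. -/
theorem proj_eq_of_smul_eq {u v r : W} (h : A.κ • u = A.κ • v + A.κ ^ 2 • r) : p u = p v := by
  rw [← sub_eq_zero, ← map_sub, hW.eq_zero_iff]
  refine hW.free.exists_eq_smul_of_smul_eq (u := r) ?_
  rw [smul_sub, h, add_sub_cancel_left]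

theorem proj_eq_of_sq_smul_eq {u v : W} (h : A.κ ^ 2 • u = A.κ ^ 2 • v) : p u = p v := by
  rw [← sub_eq_zero, ← map_sub, hW.eq_zero_iff]
  refine hW.free.exists_eq_smul_of_sq_smul_eq (u := 0) ?_
  rw [smul_sub, h, sub_self, smul_zero]

theorem exists_eq_add_smul {v w : W} (h : p v = p w) : ∃ u, v = w + A.κ • u := by
  obtain ⟨u, hu⟩ := (hW.eq_zero_iff (v - w)).1 (by rw [map_sub, h, sub_self])
  exact ⟨u, by rw [← hu]; abel⟩

variable [IsScalarTower ℂ 𝕜 W]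

theorem exists_ad_eq (a : 𝔸) (w : W) : ∃ u, bimod.ad a w = A.κ • u := by
  rw [← hW.eq_zero_iff, Bimodule.ad_apply, algebraMap_smul, map_smul, map_sub, hW.map_left,
    hW.map_right, sub_self, smul_zero]

/-- Independence of the lifts: replacing `a'` by `a' + κ b` and `w'` by `w' + κ z` changes the
commutator by `κ` times commutators, and these are again divisible by `κ`. -/
theorem proj_eq_of_ad {a a' : 𝔸} {w w' u u' r r' : W} (ha : A.proj a = A.proj a')
    (hw : p w = p w') (hu : bimod.ad a w = A.κ • u + A.κ ^ 2 • r)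
    (hu' : bimod.ad a' w' = A.κ • u' + A.κ ^ 2 • r') : p u = p u' := by
  obtain ⟨b, rfl⟩ := A.isBimoduleDeformation_self.exists_eq_add_smul ha
  obtain ⟨z, rfl⟩ := hW.exists_eq_add_smul hw
  obtain ⟨s, hs⟩ := hW.exists_ad_eq a' z
  obtain ⟨t, ht⟩ := hW.exists_ad_eq b w'
  refine hW.proj_eq_of_smul_eq (r := s + t + bimod.ad b z + r' - r) ?_
  simp only [map_add, map_smul, LinearMap.add_apply, LinearMap.smul_apply, hs, ht, hu'] at hu
  linear_combination (norm := module) (-1 : 𝕜) • hu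

/-- The element `{f, s}` with `κ {f, s} = i (a w - w a) mod κ²`, where `f = a mod κ` and
`s = w mod κ`. -/
def bracketFun (f : SmoothFun n M) (s : N) : N :=
  p (hW.exists_ad_eq (A.proj_surjective f).choose (hW.surjective s).choose).choose

theorem bracketFun_eq {a : 𝔸} {w u r : W} (h : bimod.ad a w = A.κ • u + A.κ ^ 2 • r) :
    hW.bracketFun (A.proj a) (p w) = p u := by
  have h1 := (hW.exists_ad_eq (A.proj_surjective (A.proj a)).choose
    (hW.surjective (p w)).choose).choose_spec
  exact hW.proj_eq_of_ad (r := 0) (A.proj_surjective (A.proj a)).choose_spec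
    (hW.surjective (p w)).choose_spec (by rw [smul_zero, add_zero]; exact h1) h

/-- The bracket `{f, s}` of a function and a section defined by a bimodule deformation, as a
bilinear map. -/
def bracket : SmoothFun n M →ₗ[ℂ] N →ₗ[ℂ] N :=
  LinearMap.mk₂ ℂ hW.bracketFun
    (fun f g s => by
      obtain ⟨a, rfl⟩ := A.proj_surjective f
      obtain ⟨b, rfl⟩ := A.proj_surjective g
      obtain ⟨w, rfl⟩ := hW.surjective s
      obtain ⟨u, hu⟩ := hW.exists_ad_eq a w
      obtain ⟨v, hv⟩ := hW.exists_ad_eq b w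
      rw [hW.bracketFun_eq (r := 0) (by simpa using hu),
        hW.bracketFun_eq (r := 0) (by simpa using hv), ← map_add, ← map_add]
      exact hW.bracketFun_eq (r := 0) (by simp [hu, hv]))
    (fun c f s => by
      obtain ⟨a, rfl⟩ := A.proj_surjective f
      obtain ⟨w, rfl⟩ := hW.surjective s
      obtain ⟨u, hu⟩ := hW.exists_ad_eq a w
      rw [hW.bracketFun_eq (r := 0) (by simpa using hu), ← map_smul, ← map_smul]
      refine hW.bracketFun_eq (r := 0) ?_
      rw [← algebraMap_smul 𝕜 c a, ← algebraMap_smul 𝕜 c u, map_smul, LinearMap.smul_apply, hu]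
      module)
    (fun f s t => by
      obtain ⟨a, rfl⟩ := A.proj_surjective f
      obtain ⟨w, rfl⟩ := hW.surjective s
      obtain ⟨z, rfl⟩ := hW.surjective t
      obtain ⟨u, hu⟩ := hW.exists_ad_eq a w
      obtain ⟨v, hv⟩ := hW.exists_ad_eq a z
      rw [hW.bracketFun_eq (r := 0) (by simpa using hu),
        hW.bracketFun_eq (r := 0) (by simpa using hv), ← map_add, ← map_add]
      exact hW.bracketFun_eq (r := 0) (by simp [hu, hv]))
    (fun c f s => by
      obtain ⟨a, rfl⟩ := A.proj_surjective f
      obtain ⟨w, rfl⟩ := hW.surjective s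
      obtain ⟨u, hu⟩ := hW.exists_ad_eq a w
      rw [hW.bracketFun_eq (r := 0) (by simpa using hu), ← map_smul, ← map_smul]
      refine hW.bracketFun_eq (r := 0) ?_
      rw [← algebraMap_smul 𝕜 c w, ← algebraMap_smul 𝕜 c u, map_smul, hu]
      module)

theorem bracket_eq_of_ad {a : 𝔸} {w u r : W} (h : bimod.ad a w = A.κ • u + A.κ ^ 2 • r) :
    hW.bracket (A.proj a) (p w) = p u := hW.bracketFun_eq h

theorem bracket_eq {a : 𝔸} {w u : W} (h : bimod.ad a w = A.κ • u) :
    hW.bracket (A.proj a) (p w) = p u := hW.bracket_eq_of_ad (r := 0) (by simpa using h)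

theorem bracket_mul_left (f g : SmoothFun n M) (s : N) :
    hW.bracket (f * g) s = f • hW.bracket g s + g • hW.bracket f s := by
  obtain ⟨a, rfl⟩ := A.proj_surjective f
  obtain ⟨b, rfl⟩ := A.proj_surjective g
  obtain ⟨w, rfl⟩ := hW.surjective s
  obtain ⟨u, hu⟩ := hW.exists_ad_eq a w
  obtain ⟨v, hv⟩ := hW.exists_ad_eq b w
  -- In `[ab, w] = a [b, w] + [a, w] b` the last factor acts from the right, so `map_right` is the
  -- rule to use for the second summand.
  rw [hW.bracket_eq hu, hW.bracket_eq hv, ← hW.map_left, ← hW.map_right, ← map_add, ← map_mul]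
  refine hW.bracket_eq ?_
  rw [smul_add, ← map_smul, ← map_smul, ← hu, ← hv]
  simp only [Bimodule.ad_apply, bimod.left_mul, bimod.right_mul, map_smul, map_sub,
    bimod.left_right]
  module

/-- From `[a, b w] = [a, b] w + b [a, w]`. This becomes the Leibniz rule of the contravariant
connection. -/
theorem bracket_smul_right (f h : SmoothFun n M) (s : N) :
    hW.bracket f (h • s) =
      A.isBimoduleDeformation_self.bracket f h • s + h • hW.bracket f s := by
  obtain ⟨a, rfl⟩ := A.proj_surjective f
  obtain ⟨b, rfl⟩ := A.proj_surjective h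
  obtain ⟨w, rfl⟩ := hW.surjective s
  obtain ⟨u, hu⟩ := hW.exists_ad_eq a w
  obtain ⟨c, hc⟩ := A.isBimoduleDeformation_self.exists_ad_eq a b
  have h1 : A.isBimoduleDeformation_self.bracket (A.proj a) (A.proj b) = A.proj c :=
    A.isBimoduleDeformation_self.bracket_eq hc
  rw [hW.bracket_eq hu, h1, ← hW.map_left, ← hW.map_left, ← hW.map_left, ← map_add]
  refine hW.bracket_eq ?_
  rw [smul_add, ← map_smul (bimod.left b), ← hu, ← LinearMap.smul_apply, ← map_smul, ← hc]
  simp only [Bimodule.ad_apply, selfBimodule_left, selfBimodule_right, bimod.left_mul,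
    map_smul, map_sub, bimod.left_right, LinearMap.sub_apply, LinearMap.smul_apply]
  module

/-- The Jacobi identity for commutators at order `κ²`, so that a division by `κ²` is needed. For `𝔸`
itself it is the Poisson Jacobi identity; for `Ω¹_D` it is flatness. -/
theorem bracket_bracket (f h : SmoothFun n M) (s : N) :
    hW.bracket f (hW.bracket h s) - hW.bracket h (hW.bracket f s) =
      hW.bracket (A.isBimoduleDeformation_self.bracket f h) s := by
  obtain ⟨a, rfl⟩ := A.proj_surjective f
  obtain ⟨b, rfl⟩ := A.proj_surjective h
  obtain ⟨w, rfl⟩ := hW.surjective s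
  obtain ⟨u, hu⟩ := hW.exists_ad_eq a w
  obtain ⟨v, hv⟩ := hW.exists_ad_eq b w
  obtain ⟨u', hu'⟩ := hW.exists_ad_eq b u
  obtain ⟨v', hv'⟩ := hW.exists_ad_eq a v
  obtain ⟨c, hc⟩ := A.isBimoduleDeformation_self.exists_ad_eq a b
  obtain ⟨z, hz⟩ := hW.exists_ad_eq c w
  have h1 : A.isBimoduleDeformation_self.bracket (A.proj a) (A.proj b) = A.proj c :=
    A.isBimoduleDeformation_self.bracket_eq hc
  rw [hW.bracket_eq hu, hW.bracket_eq hv, hW.bracket_eq hu', hW.bracket_eq hv', h1,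
    hW.bracket_eq hz, ← map_sub]
  refine hW.proj_eq_of_sq_smul_eq ?_
  simp only [sq, mul_smul, smul_sub]
  rw [← hz, ← hu', ← hv', ← map_smul, ← map_smul, ← hu, ← hv, ← LinearMap.smul_apply, ← map_smul,
    ← hc]
  simp only [Bimodule.ad_apply, selfBimodule_left, selfBimodule_right, bimod.left_mul,
    bimod.right_mul, map_smul, map_sub, bimod.left_right, LinearMap.sub_apply,
    LinearMap.smul_apply]
  module

end IsBimoduleDeformation

/-- The bracket `{f, h}` of functions with `κ {f, h} = i (a b - b a) mod κ²`. -/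
def SmoothDeformation.bracket (A : SmoothDeformation n M 𝕜 𝔸) :
    SmoothFun n M →ₗ[ℂ] SmoothFun n M →ₗ[ℂ] SmoothFun n M :=
  A.isBimoduleDeformation_self.bracket

theorem SmoothDeformation.bracket_self (A : SmoothDeformation n M 𝕜 𝔸) (f : SmoothFun n M) :
    A.bracket f f = 0 := by
  obtain ⟨a, rfl⟩ := A.proj_surjective f
  have := A.isBimoduleDeformation_self.bracket_eq (a := a) (w := a) (u := 0)
    (by simp [Bimodule.ad_apply, selfBimodule_left, selfBimodule_right])
  exact this.trans (map_zero _)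

theorem SmoothDeformation.bracket_mul_right (A : SmoothDeformation n M 𝕜 𝔸)
    (f g h : SmoothFun n M) :
    A.bracket f (g * h) = g * A.bracket f h + h * A.bracket f g := by
  have := A.isBimoduleDeformation_self.bracket_smul_right f g h
  rw [smul_eq_mul, smul_eq_mul, smul_eq_mul] at this
  rw [SmoothDeformation.bracket, this, add_comm, mul_comm h]

end Bracket

/-! ### Hadamard's lemma -/

section Calculus

-- The integral is the value at `0` of the convolution of the indicator of `(0, 1]` with `s ↦ ψ(s)
-- H(y, -s)`, and convolutions depend smoothly on parameters when the smooth factor has uniformly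
-- compact support.
open MeasureTheory in
theorem contDiff_intervalIntegral_zero_one {E X : Type*} [NormedAddCommGroup E] [NormedSpace ℝ E]
    [NormedAddCommGroup X] [NormedSpace ℝ X] [CompleteSpace X] {H : E × ℝ → X}
    (hH : ContDiff ℝ ∞ H) : ContDiff ℝ ∞ fun y => ∫ t in (0 : ℝ)..1, H (y, t) := by
  -- Inner radius `1` makes `ψ` equal to `1` on the range of integration; the outer radius `2`
  -- supplies the compact support.
  let ψ : ContDiffBump (0 : ℝ) := ⟨1, 2, one_pos, one_lt_two⟩
  let f : ℝ → ℝ := (Set.Ioc (0 : ℝ) 1).indicator 1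
  have hf : LocallyIntegrable f volume :=
    ((integrableOn_const (by simp) : IntegrableOn (1 : ℝ → ℝ) (Set.Ioc 0 1)
      volume).integrable_indicator measurableSet_Ioc).locallyIntegrable
  have h := contDiffOn_convolution_right_with_param (𝕜 := ℝ) (μ := volume) (n := ⊤)
    (ContinuousLinearMap.lsmul ℝ ℝ : ℝ →L[ℝ] X →L[ℝ] X) (f := f)
    (g := fun p s => ψ s • H (p, -s)) (s := Set.univ) isOpen_univ
    (isCompact_closedBall (0 : ℝ) 2) (fun p x _ hx => by
      have : ψ x = 0 := ψ.zero_of_le_dist (le_of_lt (by simpa using hx))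
      rw [this, zero_smul]) hf (by
      refine ContDiff.contDiffOn ?_
      exact (ψ.contDiff.comp contDiff_snd).smul
        (hH.comp (contDiff_fst.prodMk contDiff_snd.neg)))
  rw [Set.univ_prod_univ, contDiffOn_univ] at h
  convert h.comp (contDiff_id.prodMk (contDiff_const (c := (0 : ℝ)))) using 2 with y
  simp only [Function.comp, id, convolution_def, ContinuousLinearMap.lsmul_apply]
  rw [intervalIntegral.integral_of_le zero_le_one, ← integral_indicator measurableSet_Ioc]
  refine integral_congr_ae (Filter.Eventually.of_forall fun t => ?_)
  by_cases ht : t ∈ Set.Ioc (0 : ℝ) 1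
  · have : ψ (0 - t) = 1 := ψ.one_of_mem_closedBall (by
      simp only [zero_sub, mem_closedBall_zero_iff, norm_neg, Real.norm_eq_abs]
      exact abs_le.2 ⟨by linarith [ht.1], ht.2⟩)
    beta_reduce
    rw [this]
    simp [f, ht]
  · simp [f, ht]

/-- Take `G y` to be the average of the derivative of `f` along the segment from `y₀` to `y` and
apply the fundamental theorem of calculus. -/
theorem exists_contDiff_eq_add_apply {E X : Type*} [NormedAddCommGroup E] [NormedSpace ℝ E]
    [NormedAddCommGroup X] [NormedSpace ℝ X] [CompleteSpace X] {f : E → X}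
    (hf : ContDiff ℝ ∞ f) (y₀ : E) :
    ∃ G : E → E →L[ℝ] X, ContDiff ℝ ∞ G ∧ G y₀ = fderiv ℝ f y₀ ∧
      ∀ y, f y = f y₀ + G y (y - y₀) := by
  have hf' : ContDiff ℝ ∞ (fderiv ℝ f) := hf.fderiv_right (by simp)
  have hc : ContDiff ℝ ∞ fun q : E × ℝ => fderiv ℝ f (y₀ + q.2 • (q.1 - y₀)) :=
    hf'.comp (contDiff_const.add (contDiff_snd.smul (contDiff_fst.sub contDiff_const)))
  refine ⟨fun y => ∫ t in (0 : ℝ)..1, fderiv ℝ f (y₀ + t • (y - y₀)),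
    contDiff_intervalIntegral_zero_one hc, by simp, fun y => ?_⟩
  have hcy : Continuous fun t : ℝ => fderiv ℝ f (y₀ + t • (y - y₀)) :=
    hc.continuous.comp (continuous_const.prodMk continuous_id)
  rw [ContinuousLinearMap.intervalIntegral_apply (hcy.intervalIntegrable _ _)]
  have hd (t : ℝ) : HasDerivAt (fun t : ℝ => f (y₀ + t • (y - y₀)))
      (fderiv ℝ f (y₀ + t • (y - y₀)) (y - y₀)) t := by
    have h1 : HasDerivAt (fun t : ℝ => y₀ + t • (y - y₀)) (y - y₀) t := by
      simpa using ((hasDerivAt_id t).smul_const (y - y₀)).const_add y₀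
    exact ((hf.differentiable (by simp)) _).hasFDerivAt.comp_hasDerivAt t h1
  rw [intervalIntegral.integral_eq_sub_of_hasDerivAt (fun t _ => hd t)
    ((hcy.clm_apply continuous_const).intervalIntegrable _ _)]
  simp

end Calculus

/-! ### Functions with prescribed differential, and point derivations -/

section Geometry

variable {n : ℕ} {M : Type*} [TopologicalSpace M] [ChartedSpace (EuclideanSpace ℝ (Fin n)) M]

namespace SmoothFun

@[simp] theorem coe_mul (f g : SmoothFun n M) (x : M) :
    ((f * g : SmoothFun n M) : M → ℂ) x = (f : M → ℂ) x * (g : M → ℂ) x := rfl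

@[simp] theorem coe_add (f g : SmoothFun n M) (x : M) :
    ((f + g : SmoothFun n M) : M → ℂ) x = (f : M → ℂ) x + (g : M → ℂ) x := rfl

@[simp] theorem coe_smul (c : ℂ) (f : SmoothFun n M) (x : M) :
    ((c • f : SmoothFun n M) : M → ℂ) x = c * (f : M → ℂ) x := rfl

end SmoothFun

theorem mvfderiv_eq_fderiv_extChartAt {f : M → ℂ} {x : M}
    (hf : MDifferentiableAt (𝓡 n) 𝓘(ℝ, ℂ) f x) :
    mvfderiv (𝓡 n) f x = (fderiv ℝ (f ∘ (extChartAt (𝓡 n) x).symm) (extChartAt (𝓡 n) x x) :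
      EuclideanSpace ℝ (Fin n) →L[ℝ] ℂ) := by
  have h := hf.mfderiv
  rw [mvfderiv, h]
  simp only [writtenInExtChartAt, extChartAt_model_space_eq_id, PartialEquiv.refl_coe,
    Function.id_comp, ModelWithCorners.Boundaryless.range_eq_univ, fderivWithin_univ]
  rfl

theorem SmoothFun.mdifferentiableAt (f : SmoothFun n M) (x : M) :
    MDifferentiableAt (𝓡 n) 𝓘(ℝ, ℂ) (f : M → ℂ) x :=
  f.2.1.mdifferentiable (by simp) x

theorem SmoothFun.differentiableAt_extChartAt (f : SmoothFun n M) (x : M) :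
    DifferentiableAt ℝ ((f : M → ℂ) ∘ (extChartAt (𝓡 n) x).symm) (extChartAt (𝓡 n) x x) := by
  have := (SmoothFun.mdifferentiableAt f x).differentiableWithinAt_writtenInExtChartAt
  rwa [ModelWithCorners.Boundaryless.range_eq_univ, differentiableWithinAt_univ] at this

variable [IsManifold (𝓡 n) ∞ M]

theorem gradient_apply (f : SmoothFun n M) (x : M) :
    (gradient f : ∀ x : M, Covector n x) x = mvfderiv (𝓡 n) (f : M → ℂ) x := rfl

/-- The differential as a linear map. -/
def gradientLinear (n : ℕ) (M : Type*) [TopologicalSpace M]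
    [ChartedSpace (EuclideanSpace ℝ (Fin n)) M] [IsManifold (𝓡 n) ∞ M] :
    SmoothFun n M →ₗ[ℂ] OneForm n M where
  toFun := gradient
  map_add' f g := by
    ext1
    funext x
    exact mvfderiv_add (SmoothFun.mdifferentiableAt f x) (SmoothFun.mdifferentiableAt g x)
  map_smul' c f := by
    ext1
    funext x
    change mvfderiv (𝓡 n) ((c • f : SmoothFun n M) : M → ℂ) x = c • mvfderiv (𝓡 n) (f : M → ℂ) x
    rw [mvfderiv_eq_fderiv_extChartAt (SmoothFun.mdifferentiableAt (c • f) x),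
      mvfderiv_eq_fderiv_extChartAt (SmoothFun.mdifferentiableAt f x)]
    exact fderiv_const_smul (SmoothFun.differentiableAt_extChartAt f x) c

variable [T2Space M]

/-- The product of a bump function and a function that is smooth on the domain of the chart. -/
def SmoothFun.ofBump {x : M} (χ : SmoothBumpFunction (𝓡 n) x) (h : M → ℂ)
    (hh : ContMDiffOn (𝓡 n) 𝓘(ℝ, ℂ) ∞ h (chartAt (EuclideanSpace ℝ (Fin n)) x).source) :
    SmoothFun n M :=
  ⟨fun y => χ y • h y, χ.contMDiff_smul hh, χ.hasCompactSupport.smul_right⟩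

theorem SmoothFun.ofBump_apply {x : M} (χ : SmoothBumpFunction (𝓡 n) x) (h : M → ℂ)
    (hh : ContMDiffOn (𝓡 n) 𝓘(ℝ, ℂ) ∞ h (chartAt (EuclideanSpace ℝ (Fin n)) x).source) (y : M) :
    (SmoothFun.ofBump χ h hh : M → ℂ) y = χ y • h y := rfl

theorem SmoothFun.exists_apply_eq_one (x : M) : ∃ f : SmoothFun n M, (f : M → ℂ) x = 1 := by
  let χ : SmoothBumpFunction (𝓡 n) x := Classical.arbitrary _
  exact ⟨SmoothFun.ofBump χ (fun _ => 1) contMDiffOn_const, by simp [SmoothFun.ofBump_apply]⟩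

/-- The chart at `x` identifies the tangent space at `x` with the model space, so `α` is a linear
function of the coordinates there; cut it off with a bump function. -/
theorem exists_gradient_apply_eq (x : M) (α : Covector n x) :
    ∃ f : SmoothFun n M, (gradient f : ∀ x : M, Covector n x) x = α := by
  let χ : SmoothBumpFunction (𝓡 n) x := Classical.arbitrary _
  let a : EuclideanSpace ℝ (Fin n) →L[ℝ] ℂ := α
  let φ := extChartAt (𝓡 n) x
  have hs : ContMDiffOn (𝓡 n) 𝓘(ℝ, ℂ) ∞ (fun y => a (φ y))
      (chartAt (EuclideanSpace ℝ (Fin n)) x).source :=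
    a.contDiff.contMDiff.comp_contMDiffOn contMDiffOn_extChartAt
  refine ⟨SmoothFun.ofBump χ _ hs, ?_⟩
  rw [gradient_apply, mvfderiv_eq_fderiv_extChartAt (SmoothFun.mdifferentiableAt _ x)]
  have h1 : ((SmoothFun.ofBump χ _ hs : SmoothFun n M) : M → ℂ) ∘ φ.symm
      =ᶠ[nhds (φ x)] a := by
    have h2 : φ.symm (φ x) = x := extChartAt_to_inv x
    have h3 : Filter.Tendsto φ.symm (nhds (φ x)) (nhds x) := by
      have := (continuousAt_extChartAt_symm (I := 𝓡 n) x).tendsto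
      rwa [h2] at this
    filter_upwards [h3.eventually χ.eventuallyEq_one,
      (extChartAt_target_mem_nhds (I := 𝓡 n) x)] with y hy hy'
    rw [Function.comp, SmoothFun.ofBump_apply, hy, φ.right_inv hy']
    simp
  rw [h1.fderiv_eq, a.fderiv]

/-- Up to a cutoff, a function with vanishing differential at `x` is a constant plus products of two
functions vanishing at `x`. The algebra has no unit, so the constant has to appear as a multiple of
`ψ`. -/
theorem exists_mul_eq_of_gradient_apply_eq_zero (f : SmoothFun n M) (x : M)
    (hf : (gradient f : ∀ x : M, Covector n x) x = 0) :
    ∃ (ψ : SmoothFun n M) (u v : Fin n → SmoothFun n M), (ψ : M → ℂ) x = 1 ∧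
      (∀ i, (u i : M → ℂ) x = 0) ∧ (∀ i, (v i : M → ℂ) x = 0) ∧
      ψ * f = (f : M → ℂ) x • ψ + ∑ i, u i * v i := by
  let χ : SmoothBumpFunction (𝓡 n) x := Classical.arbitrary _
  let φ := extChartAt (𝓡 n) x
  -- The cutoff makes `f - f(x)` smooth on the whole model space, as Hadamard's lemma requires.
  let k : EuclideanSpace ℝ (Fin n) → ℂ :=
    fun y => χ.toContDiffBump y • ((f : M → ℂ) (φ.symm y) - (f : M → ℂ) x)
  have hφx : φ.symm (φ x) = x := extChartAt_to_inv x
  have hball : Metric.closedBall (φ x) χ.rOut ⊆ φ.target := by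
    have := χ.closedBall_subset
    rwa [ModelWithCorners.Boundaryless.range_eq_univ, Set.inter_univ] at this
  have hsm : ContDiffOn ℝ ∞ (fun y => (f : M → ℂ) (φ.symm y) - (f : M → ℂ) x) φ.target := by
    refine ContDiffOn.sub ?_ contDiffOn_const
    exact (f.2.1.comp_contMDiffOn (contMDiffOn_extChartAt_symm x)).contDiffOn
  have hk : ContDiff ℝ ∞ k := by
    rw [contDiff_iff_contDiffAt]
    intro y
    by_cases hy : y ∈ Metric.closedBall (φ x) χ.rOut
    · exact χ.toContDiffBump.contDiff.contDiffAt.smul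
        ((hsm y (hball hy)).contDiffAt ((isOpen_extChartAt_target x).mem_nhds (hball hy)))
    · refine (contDiffAt_const (c := (0 : ℂ))).congr_of_eventuallyEq ?_
      filter_upwards [Metric.isClosed_closedBall.isOpen_compl.mem_nhds hy] with z hz
      have : χ.toContDiffBump z = 0 :=
        χ.toContDiffBump.zero_of_le_dist (le_of_lt (not_le.1 hz))
      simp only [k]
      rw [this, zero_smul]
  have hk0 : k (φ x) = 0 := by simp [k, hφx]
  have hdk : fderiv ℝ k (φ x) = 0 := by
    have h1 : k =ᶠ[nhds (φ x)] fun y => ((f : M → ℂ) ∘ φ.symm) y - (f : M → ℂ) x := by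
      filter_upwards [χ.toContDiffBump.eventuallyEq_one] with y hy
      simp only [k, Function.comp]
      rw [hy, Pi.one_apply, one_smul]
    rw [gradient_apply, mvfderiv_eq_fderiv_extChartAt (SmoothFun.mdifferentiableAt f x)] at hf
    rw [h1.fderiv_eq, fderiv_sub_const]
    exact hf
  obtain ⟨G, hG, hG0, hGk⟩ := exists_contDiff_eq_add_apply hk (φ x)
  have hφ : ContMDiffOn (𝓡 n) 𝓘(ℝ, EuclideanSpace ℝ (Fin n)) ∞ φ
    (chartAt (EuclideanSpace ℝ (Fin n)) x).source := contMDiffOn_extChartAt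
  have hu (i : Fin n) : ContMDiffOn (𝓡 n) 𝓘(ℝ, ℂ) ∞ (fun y => ((((φ y - φ x) i : ℝ)) : ℂ))
      (chartAt (EuclideanSpace ℝ (Fin n)) x).source := by
    have : ContDiff ℝ ∞ fun z : EuclideanSpace ℝ (Fin n) => ((((z - φ x) i : ℝ)) : ℂ) :=
      Complex.ofRealCLM.contDiff.comp ((EuclideanSpace.proj i : _ →L[ℝ] ℝ).contDiff.comp
        (contDiff_id.sub contDiff_const))
    exact this.contMDiff.comp_contMDiffOn hφ
  have hv (i : Fin n) : ContMDiffOn (𝓡 n) 𝓘(ℝ, ℂ) ∞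
      (fun y => G (φ y) (EuclideanSpace.single i 1))
      (chartAt (EuclideanSpace ℝ (Fin n)) x).source :=
    (hG.clm_apply contDiff_const).contMDiff.comp_contMDiffOn hφ
  let ψ : SmoothFun n M := SmoothFun.ofBump χ (fun _ => 1) contMDiffOn_const
  -- Each of `u i`, `v i` and `k` carries one factor `χ`, so `∑ u i * v i = χ² k = χ³ (f - f(x))`;
  -- this is why the cutoff is a cube.
  refine ⟨ψ * ψ * ψ, fun i => SmoothFun.ofBump χ _ (hu i), fun i => SmoothFun.ofBump χ _ (hv i),
    by simp [ψ, SmoothFun.ofBump_apply], fun i => by simp [SmoothFun.ofBump_apply], fun i => by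
      rw [SmoothFun.ofBump_apply, hG0, hdk, zero_apply, smul_zero], ?_⟩
  ext1
  funext y
  have hsum : ((∑ i, SmoothFun.ofBump χ _ (hu i) * SmoothFun.ofBump χ _ (hv i) :
      SmoothFun n M) : M → ℂ) y = ∑ i, (SmoothFun.ofBump χ _ (hu i) : M → ℂ) y *
        (SmoothFun.ofBump χ _ (hv i) : M → ℂ) y := by
    rw [AddSubmonoidClass.coe_finsetSum, Finset.sum_apply]
    rfl
  rw [SmoothFun.coe_add, hsum]
  simp only [SmoothFun.coe_mul, SmoothFun.coe_smul, ψ, SmoothFun.ofBump_apply]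
  by_cases hy : y ∈ (chartAt (EuclideanSpace ℝ (Fin n)) x).source
  · have hy' : y ∈ φ.source := by rwa [extChartAt_source]
    have h1 := hGk (φ y)
    have h2 : G (φ y) (φ y - φ x) =
        ∑ i, (((φ y - φ x) i : ℝ) : ℂ) * G (φ y) (EuclideanSpace.single i 1) := by
      conv_lhs => rw [← (EuclideanSpace.basisFun (Fin n) ℝ).sum_repr (φ y - φ x)]
      simp [map_sum]
    have h3 : χ.toContDiffBump (φ y) = χ y := by rw [χ.eqOn_source hy]; rfl
    rw [hk0, zero_add, h2] at h1
    simp only [k, h3, φ.left_inv hy'] at h1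
    simp only [Complex.real_smul, mul_one] at h1 ⊢
    have h4 : ∑ i, (χ y : ℂ) * (((φ y - φ x) i : ℝ) : ℂ) *
        ((χ y : ℂ) * G (φ y) (EuclideanSpace.single i 1)) =
        (χ y : ℂ) * χ y * ((χ y : ℂ) * ((f : M → ℂ) y - (f : M → ℂ) x)) := by
      rw [h1, Finset.mul_sum]
      exact Finset.sum_congr rfl fun i _ => by ring
    rw [h4]
    ring
  · have : χ y = 0 := by
      by_contra h
      exact hy (χ.support_subset_source h)
    simp [this]

/-- If `df` vanishes at `x`, applying `δ` to the factorisation of `ψ f` kills every product `u i * v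
i`, cancels `f(x) δ ψ` and leaves `δ f = 0`. So `δ` factors through `f ↦ df(x)`, which is onto.
Values in an arbitrary `X` allow spaces of linear maps, hence several arguments. -/
theorem exists_linearMap_of_derivation {X : Type*} [AddCommMonoid X] [Module ℂ X] (x : M)
    (δ : SmoothFun n M →ₗ[ℂ] X)
    (hδ : ∀ f g : SmoothFun n M, δ (f * g) = (f : M → ℂ) x • δ g + (g : M → ℂ) x • δ f) :
    ∃ L : Covector n x →ₗ[ℂ] X,
      ∀ f, δ f = L ((gradient f : ∀ x : M, Covector n x) x) := by
  let : AddCommGroup X := Module.addCommMonoidToAddCommGroup ℂ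
  let γ : SmoothFun n M →ₗ[ℂ] Covector n x :=
    (LinearMap.proj (φ := fun x : M => Covector n x) x) ∘ₗ (OneForm n M).subtype ∘ₗ
      gradientLinear n M
  have hγ (f) : γ f = (gradient f : ∀ x : M, Covector n x) x := rfl
  have hker (f) (hf : γ f = 0) : δ f = 0 := by
    obtain ⟨ψ, u, v, hψ, hu, hv, h⟩ := exists_mul_eq_of_gradient_apply_eq_zero f x hf
    have h1 := congrArg δ h
    rw [hδ, map_add, map_smul, map_sum, Finset.sum_eq_zero, hψ, one_smul, add_zero] at h1
    · simpa using h1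
    · intro i _
      rw [hδ, hu, hv, zero_smul, zero_smul, add_zero]
  obtain ⟨r, hr⟩ := γ.exists_rightInverse_of_surjective
    (LinearMap.range_eq_top.2 fun α => exists_gradient_apply_eq x α)
  refine ⟨δ ∘ₗ r, fun f => ?_⟩
  rw [← hγ, LinearMap.comp_apply, ← sub_eq_zero, ← map_sub]
  refine hker _ ?_
  rw [map_sub, ← LinearMap.comp_apply γ r, hr, LinearMap.id_apply, sub_self]

end Geometry

/-! ### Generators of the module of `1`-forms, and sections with prescribed values -/

section Generators

variable {n : ℕ} {M : Type*} [TopologicalSpace M] [ChartedSpace (EuclideanSpace ℝ (Fin n)) M]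

theorem contMDiffOn_trivialization_symm {F : Type*} [NormedAddCommGroup F] [NormedSpace ℝ F]
    {V : M → Type*} [TopologicalSpace (TotalSpace F V)] [∀ x, AddCommGroup (V x)]
    [∀ x, Module ℝ (V x)] [∀ x, TopologicalSpace (V x)] [FiberBundle F V] [VectorBundle ℝ F V]
    [ContMDiffVectorBundle ∞ F V (𝓡 n)] [IsManifold (𝓡 n) ∞ M]
    (e : Trivialization F (TotalSpace.proj : TotalSpace F V → M)) [MemTrivializationAtlas e]
    (w : F) :
    ContMDiffOn (𝓡 n) ((𝓡 n).prod 𝓘(ℝ, F)) ∞ (fun x => TotalSpace.mk' F x (e.symm x w))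
      e.baseSet := by
  rw [e.contMDiffOn_section_baseSet_iff]
  refine (contMDiffOn_const (c := w)).congr fun y hy => ?_
  rw [e.apply_mk_symm hy]

namespace OneForm

variable [IsManifold (𝓡 n) ∞ M]

theorem coe_smul_apply (f : SmoothFun n M) (σ : OneForm n M) (x : M) :
    ((f • σ : OneForm n M) : ∀ x : M, Covector n x) x =
      (f : M → ℂ) x • (σ : ∀ x : M, Covector n x) x := rfl

theorem coe_add_apply (σ ρ : OneForm n M) (x : M) :
    ((σ + ρ : OneForm n M) : ∀ x : M, Covector n x) x =
      (σ : ∀ x : M, Covector n x) x + (ρ : ∀ x : M, Covector n x) x := rfl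

theorem coe_sub_apply (σ ρ : OneForm n M) (x : M) :
    ((σ - ρ : OneForm n M) : ∀ x : M, Covector n x) x =
      (σ : ∀ x : M, Covector n x) x - (ρ : ∀ x : M, Covector n x) x := rfl

theorem coe_const_smul_apply (c : ℂ) (σ : OneForm n M) (x : M) :
    ((c • σ : OneForm n M) : ∀ x : M, Covector n x) x =
      c • (σ : ∀ x : M, Covector n x) x := rfl

theorem ext {σ ρ : OneForm n M}
    (h : ∀ x, (σ : ∀ x : M, Covector n x) x = (ρ : ∀ x : M, Covector n x) x) : σ = ρ :=
  Subtype.ext (funext h)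

theorem coe_sum_apply {ι : Type*} (s : Finset ι) (σ : ι → OneForm n M) (x : M) :
    ((∑ i ∈ s, σ i : OneForm n M) : ∀ x : M, Covector n x) x =
      ∑ i ∈ s, (σ i : ∀ x : M, Covector n x) x := by
  rw [AddSubmonoidClass.coe_finsetSum, Finset.sum_apply]

theorem contMDiffOn_apply_symm (σ : OneForm n M) (x₀ : M) (v : EuclideanSpace ℝ (Fin n)) :
    ContMDiffOn (𝓡 n) 𝓘(ℝ, ℂ) ∞ (fun y => (σ : ∀ x : M, Covector n x) y
      ((trivializationAt (EuclideanSpace ℝ (Fin n)) (TangentSpace (𝓡 n) : M → Type _)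
        x₀).symm y v))
      (chartAt (EuclideanSpace ℝ (Fin n)) x₀).source := by
  intro y hy
  have h1 := contMDiffOn_trivialization_symm (n := n) (M := M)
    (V := (TangentSpace (𝓡 n) : M → Type _)) (trivializationAt (EuclideanSpace ℝ (Fin n)) (TangentSpace (𝓡 n) : M → Type _) x₀) v y hy
  have h2 := ContMDiffWithinAt.clm_bundle_apply (E₂ := Bundle.Trivial M ℂ) (F₂ := ℂ)
    (b := fun y : M => y) (σ.2.1 y).contMDiffWithinAt h1
  rw [contMDiffWithinAt_section] at h2
  exact h2

variable [T2Space M]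

/-- Locally `σ = ∑ σ_i dx^i`, with `σ_i` cut off by `θ` and `x^i` by `χ`. Having `θ = 1` near `x₀`,
and not just at `x₀`, is what the compactness argument for `induction_gradient` needs. -/
theorem exists_smul_eq_sum_gradient (x₀ : M) :
    ∃ θ : SmoothFun n M, (∀ᶠ y in nhds x₀, (θ : M → ℂ) y = 1) ∧ ∀ σ : OneForm n M,
      ∃ f h : Fin n → SmoothFun n M, θ • σ = ∑ i, f i • gradient (h i) := by
  let χ : SmoothBumpFunction (𝓡 n) x₀ := Classical.arbitrary _
  let φ := extChartAt (𝓡 n) x₀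
  obtain ⟨U, hU, hUo, hxU⟩ := eventually_nhds_iff.1 χ.eventuallyEq_one
  -- `θ` is supported where `χ` is locally `1`, so that `d(χ x^i) = dx^i` on the support of `θ`.
  obtain ⟨θ, -, hθ⟩ := (SmoothBumpFunction.nhds_basis_tsupport (I := 𝓡 n) x₀).mem_iff.1
    (hUo.mem_nhds hxU)
  refine ⟨SmoothFun.ofBump θ (fun _ => 1) contMDiffOn_const, ?_, fun σ => ?_⟩
  · filter_upwards [θ.eventuallyEq_one] with y hy
    simp [SmoothFun.ofBump_apply, hy]
  let e := trivializationAt (EuclideanSpace ℝ (Fin n)) (TangentSpace (𝓡 n) : M → Type _) x₀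
  have hh (i : Fin n) : ContMDiffOn (𝓡 n) 𝓘(ℝ, ℂ) ∞ (fun y => (((φ y i : ℝ)) : ℂ))
      (chartAt (EuclideanSpace ℝ (Fin n)) x₀).source := by
    have : ContDiff ℝ ∞ fun z : EuclideanSpace ℝ (Fin n) => (((z i : ℝ)) : ℂ) :=
      Complex.ofRealCLM.contDiff.comp (EuclideanSpace.proj i : _ →L[ℝ] ℝ).contDiff
    exact this.contMDiff.comp_contMDiffOn contMDiffOn_extChartAt
  refine ⟨fun i => SmoothFun.ofBump θ _ (contMDiffOn_apply_symm σ x₀ (EuclideanSpace.single i 1)),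
    fun i => SmoothFun.ofBump χ _ (hh i), ext fun y => ?_⟩
  rw [coe_sum_apply]
  simp only [coe_smul_apply, SmoothFun.ofBump_apply]
  by_cases hy : y ∈ tsupport θ
  swap
  · ext v
    rw [sum_apply]
    simp only [image_eq_zero_of_notMem_tsupport hy, zero_smul]
    exact (zero_mul _).trans (Finset.sum_eq_zero fun i _ => zero_mul _).symm
  have hys : y ∈ (chartAt (EuclideanSpace ℝ (Fin n)) x₀).source :=
    θ.tsupport_subset_chartAt_source hy
  have hgrad (i : Fin n) (v : TangentSpace (𝓡 n) y) :
      (gradient (SmoothFun.ofBump χ _ (hh i)) : ∀ x : M, Covector n x) y v =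
        ((((e.continuousLinearMapAt ℝ y v : EuclideanSpace ℝ (Fin n)) i : ℝ)) : ℂ) := by
    let a : EuclideanSpace ℝ (Fin n) →L[ℝ] ℂ :=
      Complex.ofRealCLM ∘L (EuclideanSpace.proj i : _ →L[ℝ] ℝ)
    have h1 : ((SmoothFun.ofBump χ _ (hh i) : SmoothFun n M) : M → ℂ) =ᶠ[nhds y] a ∘ φ := by
      filter_upwards [hUo.mem_nhds (hθ hy)] with z hz
      rw [SmoothFun.ofBump_apply, hU z hz]
      simp [a]
    have h2 : MDifferentiableAt (𝓡 n) 𝓘(ℝ, EuclideanSpace ℝ (Fin n)) φ y :=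
      mdifferentiableAt_extChartAt hys
    rw [gradient_apply, mvfderiv, h1.mfderiv_eq,
      mfderiv_comp y a.differentiableAt.mdifferentiableAt h2, mfderiv_eq_fderiv, a.fderiv,
      TangentBundle.continuousLinearMapAt_trivializationAt hys]
    rfl
  ext v
  have hv : v = e.symm y (e.continuousLinearMapAt ℝ y v) :=
    (e.symmL_continuousLinearMapAt (R := ℝ) hys v).symm.trans (e.symmL_apply (R := ℝ) hys _)
  have h3 : (σ : ∀ x : M, Covector n x) y v =
      ∑ i, (((e.continuousLinearMapAt ℝ y v : EuclideanSpace ℝ (Fin n)) i : ℝ) : ℂ) *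
        (σ : ∀ x : M, Covector n x) y (e.symm y (EuclideanSpace.single i 1)) := by
    have h4 (w : EuclideanSpace ℝ (Fin n)) : (σ : ∀ x : M, Covector n x) y (e.symm y w) =
      ∑ i, ((w i : ℝ) : ℂ) *
        (σ : ∀ x : M, Covector n x) y (e.symm y (EuclideanSpace.single i 1)) := by
      let l : EuclideanSpace ℝ (Fin n) →ₗ[ℝ] ℂ :=
        ((σ : ∀ x : M, Covector n x) y).toLinearMap ∘ₗ (e.symmL ℝ y).toLinearMap
      have hl (w) : (σ : ∀ x : M, Covector n x) y (e.symm y w) = l w := by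
        rw [← e.symmL_apply (R := ℝ) hys]
        rfl
      simp only [hl]
      conv_lhs => rw [← (EuclideanSpace.basisFun (Fin n) ℝ).sum_repr w]
      simp [map_sum]
    conv_lhs => rw [hv]
    exact h4 _
  have hev (ι : Type) (s : Finset ι) (α : ι → Covector n y) : (∑ i ∈ s, α i) v = ∑ i ∈ s, α i v :=
    sum_apply s α v
  rw [hev]
  change (θ y • (1 : ℂ)) * (σ : ∀ x : M, Covector n x) y v = ∑ i, (θ y • _) *
    (gradient (SmoothFun.ofBump χ _ (hh i)) : ∀ x : M, Covector n x) y v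
  simp only [hgrad]
  rw [h3, Finset.mul_sum]
  refine Finset.sum_congr rfl fun i _ => ?_
  simp only [Complex.real_smul, e]
  ring

/-- Every compactly supported `1`-form is a finite sum of `1`-forms `f dh`. -/
theorem induction_gradient {motive : OneForm n M → Prop}
    (smul_gradient : ∀ f h : SmoothFun n M, motive (f • gradient h))
    (add : ∀ σ ρ, motive σ → motive ρ → motive (σ + ρ)) (σ : OneForm n M) : motive σ := by
  have zero : motive 0 := by
    have := smul_gradient 0 0
    rwa [show (0 : SmoothFun n M) • gradient (0 : SmoothFun n M) = 0 from
      ext fun x => by ext v; exact zero_mul _] at this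
  -- Compactness replaces a partition of unity: passing from `σ` to `σ - θ σ` removes a sum of forms
  -- `f dh` and kills the form near a point. The last clause keeps zeros already obtained, so
  -- finitely many such steps exhaust the support.
  have key : ∀ σ : OneForm n M, ∃ ρ : OneForm n M, (motive ρ → motive σ) ∧
      (∀ x ∈ closure {x | (σ : ∀ x : M, Covector n x) x ≠ 0},
        (ρ : ∀ x : M, Covector n x) x = 0) ∧
      (∀ x, (σ : ∀ x : M, Covector n x) x = 0 → (ρ : ∀ x : M, Covector n x) x = 0) := by
    intro σ
    refine σ.2.2.induction_on (p := fun s => ∀ σ : OneForm n M, ∃ ρ : OneForm n M,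
      (motive ρ → motive σ) ∧ (∀ x ∈ s, (ρ : ∀ x : M, Covector n x) x = 0) ∧
      (∀ x, (σ : ∀ x : M, Covector n x) x = 0 → (ρ : ∀ x : M, Covector n x) x = 0))
      ?_ ?_ ?_ ?_ σ
    · exact fun σ => ⟨σ, id, by simp, fun _ => id⟩
    · intro s t hst ht σ
      obtain ⟨ρ, h1, h2, h3⟩ := ht σ
      exact ⟨ρ, h1, fun x hx => h2 x (hst hx), h3⟩
    · intro s t hs ht σ
      obtain ⟨ρ, h1, h2, h3⟩ := hs σ
      obtain ⟨τ, k1, k2, k3⟩ := ht ρ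
      exact ⟨τ, h1 ∘ k1, fun x hx => hx.elim (fun hx => k3 x (h2 x hx)) (k2 x),
        fun x hx => k3 x (h3 x hx)⟩
    · intro x _
      obtain ⟨θ, hθ, h⟩ := exists_smul_eq_sum_gradient (n := n) x
      refine ⟨_, mem_nhdsWithin_of_mem_nhds hθ, fun σ => ⟨σ - θ • σ, fun hm => ?_, ?_, ?_⟩⟩
      · obtain ⟨f, k, hfk⟩ := h σ
        have h1 : motive (θ • σ) := by
          rw [hfk]
          exact Finset.sum_induction _ motive add zero fun i _ => smul_gradient _ _
        have := add _ _ hm h1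
        exact (sub_add_cancel σ (θ • σ)) ▸ this
      · intro y hy
        rw [coe_sub_apply, coe_smul_apply, show (θ : M → ℂ) y = 1 from hy]
        ext v
        exact (congrArg (_ - ·) (one_mul _)).trans (sub_self _)
      · intro y hy
        rw [coe_sub_apply, coe_smul_apply, hy]
        ext v
        exact (congrArg ((0 : ℂ) - ·) (mul_zero _)).trans (sub_zero _)
  obtain ⟨ρ, h1, h2, h3⟩ := key σ
  refine h1 ?_
  have : ρ = 0 := ext fun x => by
    by_cases hx : (σ : ∀ x : M, Covector n x) x = 0
    · exact h3 x hx
    · exact h2 x (subset_closure hx)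
  rwa [this]

end OneForm

/-- Multiply the constant local section by a bump function. With `w ≠ 0` it is a test section from
which scalars acting on the bundle can be read off. -/
theorem Sections.exists_trivialization_eq {F : Type*} [NormedAddCommGroup F] [NormedSpace ℂ F]
    {V : M → Type*} [TopologicalSpace (TotalSpace F V)] [∀ x, AddCommGroup (V x)]
    [∀ x, Module ℂ (V x)] [∀ x, TopologicalSpace (V x)] [FiberBundle F V] [VectorBundle ℂ F V]
    [VectorBundle ℝ F V] [ContMDiffVectorBundle ∞ F V (𝓡 n)] [IsManifold (𝓡 n) ∞ M] [T2Space M]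
    (x₀ : M) (w : F) : ∃ s : Sections n F V, ∀ᶠ y in nhds x₀,
      (trivializationAt F V x₀ ⟨y, (s : ∀ x, V x) y⟩).2 = w := by
  let e := trivializationAt F V x₀
  have hx₀ : x₀ ∈ e.baseSet := FiberBundle.mem_baseSet_trivializationAt F V x₀
  obtain ⟨χ, -, hχ⟩ := (SmoothBumpFunction.nhds_basis_tsupport (I := 𝓡 n) x₀).mem_iff.1
    (e.open_baseSet.mem_nhds hx₀)
  have h1 := ContMDiffOn.smul_section_of_tsupport (n := ∞) (ψ := χ)
    (χ.contMDiff.contMDiffOn) e.open_baseSet hχ (contMDiffOn_trivialization_symm e w)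
  refine ⟨⟨fun y => χ y • e.symm y w, h1, χ.hasCompactSupport.isCompact.of_isClosed_subset
    isClosed_closure (closure_mono fun y hy h0 => hy ?_)⟩, ?_⟩
  · change χ y • e.symm y w = 0
    rw [h0, zero_smul]
  · filter_upwards [χ.eventuallyEq_one, e.open_baseSet.mem_nhds hx₀] with y hy hy'
    change (e ⟨y, χ y • e.symm y w⟩).2 = w
    rw [hy, Pi.one_apply, one_smul, e.apply_mk_symm hy']

end Generators

/-! ### The Poisson structure of a deformation -/

section PoissonStructure

variable {n : ℕ} {M : Type*} [TopologicalSpace M] [ChartedSpace (EuclideanSpace ℝ (Fin n)) M]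

theorem SmoothFun.ext {f h : SmoothFun n M} (hfh : ∀ x, (f : M → ℂ) x = (h : M → ℂ) x) : f = h :=
  Subtype.ext (funext hfh)

/-- Evaluation of functions at a point. -/
def SmoothFun.eval (x : M) : SmoothFun n M →ₗ[ℂ] ℂ where
  toFun f := (f : M → ℂ) x
  map_add' _ _ := rfl
  map_smul' _ _ := rfl

theorem SmoothFun.eval_apply (x : M) (f : SmoothFun n M) :
    SmoothFun.eval x f = (f : M → ℂ) x := rfl

variable [IsManifold (𝓡 n) ∞ M]

namespace BivectorField

variable (P : BivectorField n M)

theorem bracket_apply (f h : SmoothFun n M) (x : M) :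
    (P.bracket f h : M → ℂ) x = P.toFun x ((gradient f : ∀ x : M, Covector n x) x)
      ((gradient h : ∀ x : M, Covector n x) x) := rfl

theorem sharpDeriv_apply (σ : OneForm n M) (h : SmoothFun n M) (x : M) :
    (P.sharpDeriv σ h : M → ℂ) x = P.toFun x ((σ : ∀ x : M, Covector n x) x)
      ((gradient h : ∀ x : M, Covector n x) x) := rfl

end BivectorField

variable [T2Space M]

theorem PoissonStructure.ext_of_bracket {P Q : PoissonStructure n M}
    (h : ∀ f h, P.bracket f h = Q.bracket f h) : P = Q := by
  have key : P.toFun = Q.toFun := by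
    funext x
    refine LinearMap.ext₂ fun α β => ?_
    obtain ⟨f, rfl⟩ := exists_gradient_apply_eq x α
    obtain ⟨k, rfl⟩ := exists_gradient_apply_eq x β
    rw [← BivectorField.bracket_apply, ← BivectorField.bracket_apply, h]
  obtain ⟨⟨p, _, _⟩, _⟩ := P
  obtain ⟨⟨q, _, _⟩, _⟩ := Q
  obtain rfl : p = q := key
  rfl

variable {𝕜 𝔸 : Type*} [CommRing 𝕜] [Algebra ℂ 𝕜]
  [NonUnitalRing 𝔸] [Module ℂ 𝔸] [Module 𝕜 𝔸] [IsScalarTower ℂ 𝕜 𝔸] [IsScalarTower 𝕜 𝔸 𝔸]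
  [SMulCommClass 𝕜 𝔸 𝔸]

namespace SmoothDeformation

variable (A : SmoothDeformation n M 𝕜 𝔸)

/-- The bracket is a derivation in each argument, so the point derivation lemma is applied once to
each. -/
theorem exists_bilinear_eq_bracket (x : M) :
    ∃ ϖ : Covector n x →ₗ[ℂ] Covector n x →ₗ[ℂ] ℂ, ∀ f h : SmoothFun n M,
      (A.bracket f h : M → ℂ) x = ϖ ((gradient f : ∀ x : M, Covector n x) x)
        ((gradient h : ∀ x : M, Covector n x) x) := by
  obtain ⟨L, hL⟩ := exists_linearMap_of_derivation x
    (A.bracket.compr₂ (SmoothFun.eval x)) (fun f g => by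
      ext h
      simp only [LinearMap.compr₂_apply, LinearMap.add_apply, LinearMap.smul_apply,
        SmoothFun.eval_apply, smul_eq_mul]
      rw [SmoothDeformation.bracket, A.isBimoduleDeformation_self.bracket_mul_left]
      rfl)
  -- The values now lie in the dual of the covectors; the derivation property is tested on
  -- differentials, which exhaust them.
  obtain ⟨L', hL'⟩ := exists_linearMap_of_derivation x L.flip (fun f g => by
      ext α
      obtain ⟨k, rfl⟩ := exists_gradient_apply_eq x α
      simp only [LinearMap.add_apply, LinearMap.smul_apply, LinearMap.flip_apply, ← hL,
        LinearMap.compr₂_apply, SmoothFun.eval_apply, smul_eq_mul]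
      rw [A.bracket_mul_right]
      rfl)
  refine ⟨L'.flip, fun f h => ?_⟩
  rw [LinearMap.flip_apply, ← hL', LinearMap.flip_apply, ← hL]
  rfl

/-- The bracket of functions of a smooth deformation is the bracket of a Poisson structure. -/
theorem exists_poissonStructure :
    ∃ P : PoissonStructure n M, ∀ f h, P.bracket f h = A.bracket f h := by
  choose ϖ hϖ using A.exists_bilinear_eq_bracket
  -- It suffices to treat `σ = f dh` and `ρ = k dl`, where the function is `f k {h, l}`.
  have hsmooth (σ ρ : OneForm n M) : ContMDiff (𝓡 n) 𝓘(ℝ, ℂ) ∞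
      (fun x => ϖ x ((σ : ∀ x : M, Covector n x) x) ((ρ : ∀ x : M, Covector n x) x)) := by
    induction σ using OneForm.induction_gradient with
    | add σ τ h1 h2 =>
      simp only [OneForm.coe_add_apply, map_add, LinearMap.add_apply]
      exact h1.add h2
    | smul_gradient f h =>
      simp only [OneForm.coe_smul_apply, map_smul, LinearMap.smul_apply]
      refine contMDiff_mul_complex f.2.1 ?_
      induction ρ using OneForm.induction_gradient with
      | add σ τ h1 h2 =>
        simp only [OneForm.coe_add_apply, map_add]
        exact h1.add h2
      | smul_gradient k l =>
        simp only [OneForm.coe_smul_apply, map_smul]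
        refine contMDiff_mul_complex k.2.1 ?_
        simp only [← hϖ]
        exact (A.bracket h l).2.1
  let P₀ : BivectorField n M :=
    { toFun := ϖ
      alternating := fun x α => by
        obtain ⟨f, rfl⟩ := exists_gradient_apply_eq x α
        rw [← hϖ, A.bracket_self]
        rfl
      smooth := hsmooth }
  have hP (f h) : P₀.bracket f h = A.bracket f h := SmoothFun.ext fun x => (hϖ x f h).symm
  refine ⟨{ P₀ with jacobi := fun f g h => ?_ }, hP⟩
  simp only [hP]
  have hskew (f h : SmoothFun n M) : A.bracket f h = - A.bracket h f :=
    ((LinearMap.IsAlt.neg (B := A.bracket) A.bracket_self) h f).symm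
  have h1 : A.bracket f (A.bracket g h) - A.bracket g (A.bracket f h) =
    A.bracket (A.bracket f g) h := A.isBimoduleDeformation_self.bracket_bracket f g h
  rw [hskew h f, hskew h, map_neg, ← h1]
  abel

omit [T2Space M] in
theorem isPoissonStructure_iff (P : PoissonStructure n M) :
    A.IsPoissonStructure P ↔ ∀ f h, P.bracket f h = A.bracket f h := by
  have had (a b : 𝔸) : (selfBimodule 𝕜 𝔸).ad a b = Complex.I • (a * b - b * a) :=
    algebraMap_smul 𝕜 Complex.I _
  constructor
  · intro h f k
    obtain ⟨a, rfl⟩ := A.proj_surjective f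
    obtain ⟨b, rfl⟩ := A.proj_surjective k
    obtain ⟨c, hc⟩ := A.proj_surjective (P.bracket (A.proj a) (A.proj b))
    obtain ⟨d, hd⟩ := h a b c hc
    rw [← hc]
    refine (A.isBimoduleDeformation_self.bracket_eq_of_ad (u := c) (r := -d) ?_).symm
    rw [hd, had]
    module
  · intro h a b c hc
    obtain ⟨e, he⟩ := A.isBimoduleDeformation_self.exists_ad_eq a b
    have h1 : A.bracket (A.proj a) (A.proj b) = A.proj e :=
      A.isBimoduleDeformation_self.bracket_eq he
    rw [h, h1] at hc
    obtain ⟨u, rfl⟩ := A.isBimoduleDeformation_self.exists_eq_add_smul hc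
    refine ⟨u, ?_⟩
    rw [← had, he]
    module

theorem existsUnique_isPoissonStructure : ∃! P : PoissonStructure n M, A.IsPoissonStructure P := by
  obtain ⟨P, hP⟩ := A.exists_poissonStructure
  refine ⟨P, (A.isPoissonStructure_iff P).2 hP, fun Q hQ => ?_⟩
  refine PoissonStructure.ext_of_bracket fun f h => ?_
  rw [hP, (A.isPoissonStructure_iff Q).1 hQ]

end SmoothDeformation

end PoissonStructure

/-! ### The pairing of covectors -/

section Pairing

variable {n : ℕ} {M : Type*} [TopologicalSpace M] [ChartedSpace (EuclideanSpace ℝ (Fin n)) M]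
  [IsManifold (𝓡 n) ∞ M]

namespace PseudoRiemannianMetric

variable (g : PseudoRiemannianMetric n M) (x : M)

theorem lower_apply (v w : TangentSpace (𝓡 n) x) : g.lower x v w = g.inner x v w := rfl

theorem apply_lower_symm_comm (a b : TangentSpace (𝓡 n) x →L[ℝ] ℝ) :
    a ((g.lower x).symm b) = b ((g.lower x).symm a) := by
  obtain ⟨v, rfl⟩ := (g.lower x).surjective a
  obtain ⟨w, rfl⟩ := (g.lower x).surjective b
  rw [LinearEquiv.symm_apply_apply, LinearEquiv.symm_apply_apply, lower_apply, lower_apply, g.symm]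

theorem pairing_comm (α β : Covector n x) : g.pairing x α β = g.pairing x β α := by
  have h (γ : Covector n x) (v : TangentSpace (𝓡 n) x) : γ v =
      (((Complex.reCLM ∘L γ) v : ℝ) : ℂ) + (((Complex.imCLM ∘L γ) v : ℝ) : ℂ) * Complex.I :=
    (Complex.re_add_im (γ v)).symm
  rw [pairing, pairing, h α, h α, h β, h β, g.apply_lower_symm_comm x (Complex.reCLM ∘L β),
    g.apply_lower_symm_comm x (Complex.imCLM ∘L β), g.apply_lower_symm_comm x (Complex.reCLM ∘L β),
    g.apply_lower_symm_comm x (Complex.imCLM ∘L β)]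
  ring

theorem pairing_sub_left (α β γ : Covector n x) :
    g.pairing x (α - β) γ = g.pairing x α γ - g.pairing x β γ := by
  simp only [pairing, sub_apply]
  ring

/-- Pairing `α` with the real covector `g(v, ·)` returns `α v`. -/
theorem eq_zero_of_pairing_eq_zero {α : Covector n x} (h : ∀ β, g.pairing x α β = 0) : α = 0 := by
  ext v
  have h1 := h (Complex.ofRealCLM ∘L g.lower x v)
  have h2 : Complex.reCLM ∘L (Complex.ofRealCLM ∘L g.lower x v) = g.lower x v := by
    ext w
    exact Complex.ofReal_re (g.lower x v w)
  have h3 : Complex.imCLM ∘L (Complex.ofRealCLM ∘L g.lower x v) = 0 := by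
    ext w
    exact Complex.ofReal_im (g.lower x v w)
  rw [pairing, h2, h3, map_zero, map_zero, mul_zero, add_zero, LinearEquiv.symm_apply_apply] at h1
  exact h1

end PseudoRiemannianMetric

end Pairing

/-! ### Koszul brackets and metric contravariant connections -/

section Connections

variable {n : ℕ} {M : Type*} [TopologicalSpace M] [ChartedSpace (EuclideanSpace ℝ (Fin n)) M]
  [IsManifold (𝓡 n) ∞ M]

namespace OneForm

theorem smul_add (f : SmoothFun n M) (σ ρ : OneForm n M) : f • (σ + ρ) = f • σ + f • ρ :=
  ext fun x => by ext v; exact mul_add _ _ _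

theorem smul_neg (f : SmoothFun n M) (σ : OneForm n M) : f • (-σ) = -(f • σ) :=
  ext fun x => by ext v; exact mul_neg _ _

theorem smul_zero (f : SmoothFun n M) : f • (0 : OneForm n M) = 0 :=
  ext fun x => by ext v; exact mul_zero _

theorem smul_sub (f : SmoothFun n M) (σ ρ : OneForm n M) : f • (σ - ρ) = f • σ - f • ρ :=
  ext fun x => by ext v; exact mul_sub _ _ _

theorem map_neg (L : OneForm n M →ₗ[ℂ] OneForm n M) (σ : OneForm n M) : L (-σ) = -L σ := by
  have h : ∀ ρ : OneForm n M, -ρ = (-1 : ℂ) • ρ :=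
    fun ρ => ext fun x => by ext v; exact (neg_one_mul _).symm
  rw [h, map_smul, h]

theorem map_neg₂ (L : OneForm n M →ₗ[ℂ] OneForm n M →ₗ[ℂ] OneForm n M) (σ ρ : OneForm n M) :
    L (-σ) ρ = -L σ ρ :=
  map_neg (L.flip ρ) σ

theorem neg_add (σ ρ : OneForm n M) : -(σ + ρ) = -σ + -ρ := by abel

theorem neg_eq_of_add_eq_zero {σ ρ : OneForm n M} (h : σ + ρ = 0) : -σ = ρ :=
  ext fun x => by
    ext v
    exact neg_eq_of_add_eq_zero_right
      (congrArg (fun τ : OneForm n M => (τ : ∀ x : M, Covector n x) x v) h)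

theorem neg_zero : -(0 : OneForm n M) = 0 := by abel

end OneForm

variable {P : PoissonStructure n M}

namespace PoissonStructure.IsKoszulBracket

variable {B : OneForm n M →ₗ[ℂ] OneForm n M →ₗ[ℂ] OneForm n M}

theorem neg_swap (hB : P.IsKoszulBracket B) (σ ρ : OneForm n M) : -B σ ρ = B ρ σ :=
  OneForm.neg_eq_of_add_eq_zero (by
    have h := hB.alternating (σ + ρ)
    rwa [map_add, map_add, LinearMap.add_apply, LinearMap.add_apply, hB.alternating,
      hB.alternating, zero_add, add_zero, add_comm] at h)

/-- The Leibniz rule reduces the second argument to a differential; alternation exchanges the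
arguments and the same reduction applies to the other one. -/
theorem eq [T2Space M] (hB : P.IsKoszulBracket B)
    {B' : OneForm n M →ₗ[ℂ] OneForm n M →ₗ[ℂ] OneForm n M} (hB' : P.IsKoszulBracket B') :
    B = B' := by
  refine LinearMap.ext₂ fun σ ρ => ?_
  induction ρ using OneForm.induction_gradient with
  | add ρ τ h1 h2 => rw [map_add, map_add, h1, h2]
  | smul_gradient f h =>
    rw [hB.leibniz, hB'.leibniz]
    congr 2
    rw [← hB.neg_swap, ← hB'.neg_swap]
    congr 1
    induction σ using OneForm.induction_gradient with
    | add ρ τ h1 h2 => rw [map_add, map_add, h1, h2]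
    | smul_gradient k l => rw [hB.leibniz, hB'.leibniz, hB.gradient, hB'.gradient]

end PoissonStructure.IsKoszulBracket

namespace ContravariantConnection

variable {B : OneForm n M →ₗ[ℂ] OneForm n M →ₗ[ℂ] OneForm n M}

/-- The antisymmetrisation of a contravariant connection is automatically alternating and satisfies
the Leibniz rule, so only its values on exact forms need checking. -/
theorem isKoszulBracket_of_forall_eq (𝒟 : ContravariantConnection P)
    (hB : ∀ σ ρ, B σ ρ = 𝒟.toFun σ ρ - 𝒟.toFun ρ σ)
    (h : ∀ f h, 𝒟.toFun (gradient f) (gradient h) - 𝒟.toFun (gradient h) (gradient f) =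
      gradient (P.bracket f h)) : P.IsKoszulBracket B where
  alternating σ := by
    rw [hB]
    abel
  gradient f k := by rw [hB, h]
  leibniz σ ρ f := by
    rw [hB, hB, 𝒟.smul_left, 𝒟.leibniz, OneForm.smul_sub]
    abel

theorem exists_isKoszulBracket (𝒟 : ContravariantConnection P)
    (h : ∀ f h, 𝒟.toFun (gradient f) (gradient h) - 𝒟.toFun (gradient h) (gradient f) =
      gradient (P.bracket f h)) :
    ∃ B, P.IsKoszulBracket B ∧ ∀ σ ρ, B σ ρ = 𝒟.toFun σ ρ - 𝒟.toFun ρ σ := by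
  have hB (σ ρ : OneForm n M) : (𝒟.toFun + (-1 : ℂ) • 𝒟.toFun.flip) σ ρ =
      𝒟.toFun σ ρ - 𝒟.toFun ρ σ := by
    rw [LinearMap.add_apply, LinearMap.add_apply, LinearMap.smul_apply, LinearMap.smul_apply,
      LinearMap.flip_apply]
    refine OneForm.ext fun x => ?_
    ext v
    change (𝒟.toFun σ ρ : ∀ x : M, Covector n x) x v +
      (-1 : ℂ) * (𝒟.toFun ρ σ : ∀ x : M, Covector n x) x v =
      (𝒟.toFun σ ρ : ∀ x : M, Covector n x) x v - (𝒟.toFun ρ σ : ∀ x : M, Covector n x) x v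
    ring
  exact ⟨_, 𝒟.isKoszulBracket_of_forall_eq hB h, hB⟩

theorem ext_toFun {𝒟 𝒟' : ContravariantConnection P} (h : ∀ σ ρ, 𝒟.toFun σ ρ = 𝒟'.toFun σ ρ) :
    𝒟 = 𝒟' := by
  have h' : 𝒟.toFun = 𝒟'.toFun := LinearMap.ext₂ h
  obtain ⟨D, _, _⟩ := 𝒟
  obtain ⟨D', _, _⟩ := 𝒟'
  obtain rfl : D = D' := h'
  rfl

/-- The difference of two such connections, lowered by the metric, is symmetric in its first two
arguments (torsion) and skew in its last two (metric), hence zero. -/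
theorem IsMetricConnection.eq [T2Space M] {g : PseudoRiemannianMetric n M}
    {𝒟 𝒟' : ContravariantConnection P} (h : 𝒟.IsMetricConnection B g)
    (h' : 𝒟'.IsMetricConnection B g) : 𝒟 = 𝒟' := by
  refine ext_toFun fun σ ρ => OneForm.ext fun x => ?_
  let S (α β γ : OneForm n M) : ℂ := g.pairing x
    ((𝒟.toFun α β : ∀ x : M, Covector n x) x - (𝒟'.toFun α β : ∀ x : M, Covector n x) x)
    ((γ : ∀ x : M, Covector n x) x)
  have hsymm (α β γ : OneForm n M) : S α β γ = S β α γ := by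
    simp only [S]
    congr 1
    ext v
    have h1 := congrArg (fun τ : OneForm n M => (τ : ∀ x : M, Covector n x) x v)
      (h.torsion_free α β)
    have h2 := congrArg (fun τ : OneForm n M => (τ : ∀ x : M, Covector n x) x v)
      (h'.torsion_free α β)
    have h3 : (𝒟.toFun α β : ∀ x : M, Covector n x) x v -
      (𝒟.toFun β α : ∀ x : M, Covector n x) x v - (B α β : ∀ x : M, Covector n x) x v = 0 := h1
    have h4 : (𝒟'.toFun α β : ∀ x : M, Covector n x) x v -
      (𝒟'.toFun β α : ∀ x : M, Covector n x) x v - (B α β : ∀ x : M, Covector n x) x v = 0 := h2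
    rw [sub_apply, sub_apply]
    linear_combination h3 - h4
  have hskew (α β γ : OneForm n M) : S α β γ = - S α γ β := by
    have h1 := h.metric_compatible α β γ x
    have h2 := h'.metric_compatible α β γ x
    simp only [S, g.pairing_sub_left]
    rw [g.pairing_comm x _ ((γ : ∀ x : M, Covector n x) x),
      g.pairing_comm x _ ((γ : ∀ x : M, Covector n x) x),
      g.pairing_comm x _ ((β : ∀ x : M, Covector n x) x),
      g.pairing_comm x _ ((β : ∀ x : M, Covector n x) x)]
    rw [g.pairing_comm x _ ((γ : ∀ x : M, Covector n x) x)] at h1 h2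
    linear_combination h2 - h1
  have hzero (α β γ : OneForm n M) : S α β γ = 0 := by
    have h1 : S α β γ = - S α β γ :=
      calc S α β γ = - S α γ β := hskew _ _ _
        _ = - S γ α β := by rw [hsymm]
        _ = S γ β α := by rw [hskew, neg_neg]
        _ = S β γ α := hsymm _ _ _
        _ = - S β α γ := hskew _ _ _
        _ = - S α β γ := by rw [hsymm]
    linear_combination h1 / 2
  refine sub_eq_zero.1 (g.eq_zero_of_pairing_eq_zero x fun α => ?_)
  obtain ⟨f, rfl⟩ := exists_gradient_apply_eq x α
  exact hzero σ ρ (gradient f)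

/-- The terms `#ρ(f) 𝒟_σ τ` produced by `𝒟_ρ 𝒟_{fσ} τ` and by `𝒟_{[fσ, ρ]} τ` cancel. -/
theorem curvature_smul_left (hB : P.IsKoszulBracket B) (𝒟 : ContravariantConnection P)
    (f : SmoothFun n M) (σ ρ τ : OneForm n M) :
    𝒟.curvature B (f • σ) ρ τ = f • 𝒟.curvature B σ ρ τ := by
  have h1 : B (f • σ) ρ = -(P.sharpDeriv ρ f • σ) + f • B σ ρ := by
    rw [← hB.neg_swap, hB.leibniz, ← hB.neg_swap, OneForm.smul_neg]
    abel
  have e2 : 𝒟.toFun ρ (𝒟.toFun (f • σ) τ) =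
      P.sharpDeriv ρ f • 𝒟.toFun σ τ + f • 𝒟.toFun ρ (𝒟.toFun σ τ) :=
    (congrArg (𝒟.toFun ρ) (𝒟.smul_left f σ τ)).trans (𝒟.leibniz ρ f (𝒟.toFun σ τ))
  have e3 : 𝒟.toFun (B (f • σ) ρ) τ =
      -(P.sharpDeriv ρ f • 𝒟.toFun σ τ) + f • 𝒟.toFun (B σ ρ) τ := by
    rw [h1, map_add, LinearMap.add_apply, OneForm.map_neg₂]
    exact congrArg₂ (-· + ·) (𝒟.smul_left _ σ τ) (𝒟.smul_left f (B σ ρ) τ)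
  have key : ∀ {a b c a' b' c' t : OneForm n M}, a = a' → b = b' → c = c' → a' - b' - c' = t →
      a - b - c = t := by
    rintro a b c _ _ _ _ rfl rfl rfl h
    exact h
  have key' (a b c d : OneForm n M) : a - (d + b) - (-d + c) = a - b - c := by abel
  unfold curvature
  rw [OneForm.smul_sub, OneForm.smul_sub]
  exact key (𝒟.smul_left f σ (𝒟.toFun ρ τ)) e2 e3 (key' _ _ _ _)

theorem curvature_swap (hB : P.IsKoszulBracket B) (𝒟 : ContravariantConnection P)
    (σ ρ τ : OneForm n M) : 𝒟.curvature B σ ρ τ = - 𝒟.curvature B ρ σ τ := by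
  rw [curvature, curvature, ← hB.neg_swap, OneForm.map_neg₂]
  abel

theorem curvature_add_left (𝒟 : ContravariantConnection P) (σ σ' ρ τ : OneForm n M) :
    𝒟.curvature B (σ + σ') ρ τ = 𝒟.curvature B σ ρ τ + 𝒟.curvature B σ' ρ τ := by
  rw [curvature, curvature, curvature]
  simp only [map_add, LinearMap.add_apply]
  abel

/-- Tensoriality in `σ`, and in `ρ` by antisymmetry, reduces to exact forms; `τ` stays arbitrary, so
tensoriality in `τ` is not needed. -/
theorem isFlat_of_gradient [T2Space M] (hB : P.IsKoszulBracket B) (𝒟 : ContravariantConnection P)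
    (h : ∀ f k τ, 𝒟.curvature B (gradient f) (gradient k) τ = 0) : 𝒟.IsFlat B := by
  intro σ ρ τ
  induction σ using OneForm.induction_gradient with
  | add σ σ' h1 h2 => rw [curvature_add_left, h1, h2, add_zero]
  | smul_gradient f k =>
    rw [curvature_smul_left hB, curvature_swap hB]
    induction ρ using OneForm.induction_gradient with
    | add σ σ' h1 h2 =>
      rw [curvature_add_left, OneForm.neg_add, OneForm.smul_add, h1, h2, add_zero]
    | smul_gradient l m =>
      rw [curvature_smul_left hB, h, OneForm.smul_zero, OneForm.neg_zero, OneForm.smul_zero]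

end ContravariantConnection

variable [T2Space M] {𝕜 𝔸 : Type*} [CommRing 𝕜] [Algebra ℂ 𝕜]
  [NonUnitalRing 𝔸] [Module ℂ 𝔸] [Module 𝕜 𝔸] [IsScalarTower ℂ 𝕜 𝔸] [IsScalarTower 𝕜 𝔸 𝔸]
  [SMulCommClass 𝕜 𝔸 𝔸] {A : SmoothDeformation n M 𝕜 𝔸}
  {W : Type*} [AddCommGroup W] [Module ℂ W] [Module 𝕜 W] [IsScalarTower ℂ 𝕜 W]
  {bimod : Bimodule 𝕜 𝔸 W} {p : W →ₗ[ℂ] OneForm n M}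

/-- At a fixed point, `h ↦ {h, ·}` is a point derivation with values in linear maps from forms to
covectors. -/
theorem IsBimoduleDeformation.exists_linearMap_bracket
    (hW : IsBimoduleDeformation A (OneForm n M) bimod p) (x : M) :
    ∃ L : Covector n x →ₗ[ℂ] OneForm n M →ₗ[ℂ] Covector n x,
      ∀ (h : SmoothFun n M) (ρ : OneForm n M),
        L ((gradient h : ∀ x : M, Covector n x) x) ρ =
          (hW.bracket h ρ : ∀ x : M, Covector n x) x := by
  have hex := exists_linearMap_of_derivation x
    (hW.bracket.compr₂ ((LinearMap.proj (R := ℂ) (φ := fun x : M => Covector n x) x) ∘ₗ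
      (OneForm n M).subtype)) (fun f g => by
      refine LinearMap.ext fun ρ => ?_
      simp only [LinearMap.compr₂_apply, LinearMap.add_apply, LinearMap.smul_apply,
        LinearMap.comp_apply, hW.bracket_mul_left]
      rfl)
  obtain ⟨L, hL⟩ := hex
  exact ⟨L, fun h ρ => (congrArg (fun l => l ρ) (hL h)).symm⟩

/-- The bracket of functions and `1`-forms that is defined by a bimodule deformation of `1`-forms
extends to a contravariant connection. -/
theorem IsBimoduleDeformation.exists_contravariantConnection
    (hW : IsBimoduleDeformation A (OneForm n M) bimod p)
    (hP : ∀ f h, P.bracket f h = A.bracket f h) :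
    ∃ 𝒟 : ContravariantConnection P, ∀ (σ ρ : OneForm n M) (h : SmoothFun n M) (x : M),
      (σ : ∀ x : M, Covector n x) x = (gradient h : ∀ x : M, Covector n x) x →
      (𝒟.toFun σ ρ : ∀ x : M, Covector n x) x = (hW.bracket h ρ : ∀ x : M, Covector n x) x := by
  choose L hL using hW.exists_linearMap_bracket
  -- The pointwise recipe `x ↦ L x (σ x) ρ` gives a smooth compactly supported form, because for `σ
  -- = f dh` it is `f {h, ρ}`.
  have hform (σ ρ : OneForm n M) : ∃ τ : OneForm n M, ∀ x,
      (τ : ∀ x : M, Covector n x) x = L x ((σ : ∀ x : M, Covector n x) x) ρ := by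
    induction σ using OneForm.induction_gradient with
    | add σ σ' h1 h2 =>
      obtain ⟨τ, hτ⟩ := h1
      obtain ⟨τ', hτ'⟩ := h2
      refine ⟨τ + τ', fun x => ?_⟩
      rw [OneForm.coe_add_apply, OneForm.coe_add_apply, map_add, hτ, hτ', LinearMap.add_apply]
    | smul_gradient f h =>
      refine ⟨f • hW.bracket h ρ, fun x => ?_⟩
      rw [OneForm.coe_smul_apply, OneForm.coe_smul_apply, map_smul, LinearMap.smul_apply, hL]
  choose D hD using hform
  let D' : OneForm n M →ₗ[ℂ] OneForm n M →ₗ[ℂ] OneForm n M := LinearMap.mk₂ ℂ D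
    (fun σ σ' ρ => OneForm.ext fun x => by
      rw [OneForm.coe_add_apply, hD, hD, hD, OneForm.coe_add_apply, map_add, LinearMap.add_apply])
    (fun c σ ρ => OneForm.ext fun x => by
      rw [OneForm.coe_const_smul_apply, hD, hD, OneForm.coe_const_smul_apply, map_smul,
        LinearMap.smul_apply])
    (fun σ ρ ρ' => OneForm.ext fun x => by rw [OneForm.coe_add_apply, hD, hD, hD, map_add])
    (fun c σ ρ => OneForm.ext fun x => by rw [OneForm.coe_const_smul_apply, hD, hD, map_smul])
  have hD' (σ ρ : OneForm n M) (x : M) : (D' σ ρ : ∀ x : M, Covector n x) x =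
    L x ((σ : ∀ x : M, Covector n x) x) ρ := hD σ ρ x
  clear_value D'
  refine ⟨⟨D', fun f σ ρ => OneForm.ext fun x => ?_, fun σ f ρ => OneForm.ext fun x => ?_⟩,
    fun σ ρ h x hσ => ?_⟩
  · rw [OneForm.coe_smul_apply, hD', hD', OneForm.coe_smul_apply, map_smul, LinearMap.smul_apply]
  -- At the given point `σ` may be replaced by a differential `dh`, and the claim becomes the
  -- Leibniz rule of `{h, ·}`.
  · obtain ⟨h, hh⟩ := exists_gradient_apply_eq x ((σ : ∀ x : M, Covector n x) x)
    have e1 (ρ : OneForm n M) : (D' σ ρ : ∀ x : M, Covector n x) x =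
        (hW.bracket h ρ : ∀ x : M, Covector n x) x := by rw [hD', ← hh, hL]
    have e2 : (P.sharpDeriv σ f : M → ℂ) x = (A.bracket h f : M → ℂ) x := by
      rw [BivectorField.sharpDeriv_apply, ← hh]
      exact congrArg (fun k : SmoothFun n M => (k : M → ℂ) x) (hP h f)
    rw [OneForm.coe_add_apply, OneForm.coe_smul_apply, OneForm.coe_smul_apply, e1, e1]
    exact (congrArg (fun τ : OneForm n M => (τ : ∀ x : M, Covector n x) x)
      (hW.bracket_smul_right h f ρ)).trans (congrArg (fun c : ℂ =>
        c • (ρ : ∀ x : M, Covector n x) x +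
          (f : M → ℂ) x • (hW.bracket h ρ : ∀ x : M, Covector n x) x) e2.symm)
  · exact (hD' σ ρ x).trans ((congrArg (fun α => L x α ρ) hσ).trans (hL x h ρ))

end Connections

/-! ### The metric contravariant connection of a deformed spectral triple -/

section Spectral

variable {n : ℕ} {M : Type*} [TopologicalSpace M] [ChartedSpace (EuclideanSpace ℝ (Fin n)) M]

section Sections

variable {F : Type*} [NormedAddCommGroup F] [NormedSpace ℂ F]
  {V : M → Type*} [TopologicalSpace (TotalSpace F V)] [∀ x, AddCommGroup (V x)]
  [∀ x, Module ℂ (V x)] [∀ x, TopologicalSpace (V x)] [FiberBundle F V] [VectorBundle ℂ F V]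

theorem Sections.ext {s t : Sections n F V}
    (h : ∀ x, (s : ∀ x, V x) x = (t : ∀ x, V x) x) : s = t :=
  Subtype.ext (funext h)

theorem Sections.coe_smul_apply (f : SmoothFun n M) (s : Sections n F V) (x : M) :
    ((f • s : Sections n F V) : ∀ x, V x) x = (f : M → ℂ) x • (s : ∀ x, V x) x := rfl

theorem Sections.coe_add_apply (s t : Sections n F V) (x : M) :
    ((s + t : Sections n F V) : ∀ x, V x) x = (s : ∀ x, V x) x + (t : ∀ x, V x) x := rfl

theorem Sections.coe_sub_apply (s t : Sections n F V) (x : M) :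
    ((s - t : Sections n F V) : ∀ x, V x) x = (s : ∀ x, V x) x - (t : ∀ x, V x) x := rfl

theorem Sections.coe_const_smul_apply (c : ℂ) (s : Sections n F V) (x : M) :
    ((c • s : Sections n F V) : ∀ x, V x) x = c • (s : ∀ x, V x) x := rfl

end Sections

/-- The projection `p` is only `ℂ`-linear; a scalar `k` of `𝕜` is moved into the algebra by `a (k w)
= (k a) w`. -/
theorem IsBimoduleDeformation.smul_proj_smul {𝕜 𝔸 : Type*} [CommRing 𝕜] [Algebra ℂ 𝕜]
    [NonUnitalRing 𝔸] [Module ℂ 𝔸] [Module 𝕜 𝔸] [IsScalarTower ℂ 𝕜 𝔸] [IsScalarTower 𝕜 𝔸 𝔸]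
    [SMulCommClass 𝕜 𝔸 𝔸] {A : SmoothDeformation n M 𝕜 𝔸}
    {W : Type*} [AddCommGroup W] [Module ℂ W] [Module 𝕜 W] {N : Type*} [AddCommGroup N]
    [Module ℂ N] [SMul (SmoothFun n M) N] {bimod : Bimodule 𝕜 𝔸 W} {p : W →ₗ[ℂ] N}
    (hW : IsBimoduleDeformation A N bimod p) (k : 𝕜) (a : 𝔸) (w : W) :
    A.proj a • p (k • w) = A.proj (k • a) • p w := by
  rw [← hW.map_left, ← hW.map_left, map_smul (bimod.left a), map_smul bimod.left, LinearMap.smul_apply]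

variable [IsManifold (𝓡 n) ∞ M] {g : PseudoRiemannianMetric n M}
  {F : Type*} [NormedAddCommGroup F] [NormedSpace ℂ F]
  {V : M → Type*} [TopologicalSpace (TotalSpace F V)] [∀ x, AddCommGroup (V x)]
  [∀ x, Module ℂ (V x)] [∀ x, TopologicalSpace (V x)] [FiberBundle F V] [VectorBundle ℂ F V]

namespace CliffordRepresentation

theorem act_apply (c : CliffordRepresentation g F V) (σ : OneForm n M) (s : Sections n F V)
    (x : M) : (c.act σ s : ∀ x, V x) x =
      c.toFun x ((σ : ∀ x : M, Covector n x) x) ((s : ∀ x, V x) x) := rfl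

variable [T2Space M] [Nontrivial F] [VectorBundle ℝ F V] [ContMDiffVectorBundle ∞ F V (𝓡 n)]

/-- The Clifford relation exhibits `2⟨σ, ρ⟩ s` as a smooth section. For `s` locally constant in a
trivialization, with value `w`, a functional with `l w = 1` extracts the coefficient. -/
theorem contMDiff_pairing (c : CliffordRepresentation g F V) (σ ρ : OneForm n M) :
    ContMDiff (𝓡 n) 𝓘(ℝ, ℂ) ∞ (fun x => g.pairing x ((σ : ∀ x : M, Covector n x) x)
      ((ρ : ∀ x : M, Covector n x) x)) := by
  intro x₀
  obtain ⟨w, hw⟩ := exists_ne (0 : F)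
  obtain ⟨l, hl⟩ := SeparatingDual.exists_eq_one (R := ℂ) hw
  obtain ⟨s, hs⟩ := Sections.exists_trivialization_eq (n := n) (V := V) x₀ w
  let e := trivializationAt F V x₀
  let t : Sections n F V := c.act σ (c.act ρ s) + c.act ρ (c.act σ s)
  have h1 := (Bundle.contMDiffAt_section x₀).1 (t.2.1 x₀)
  have h2 : ContMDiffAt (𝓡 n) 𝓘(ℝ, ℂ) ∞
      (fun x => (2⁻¹ : ℂ) * l (e ⟨x, (t : ∀ x, V x) x⟩).2) x₀ :=
    (contDiff_const.mul (l.restrictScalars ℝ).contDiff).contMDiff.contMDiffAt.comp x₀ h1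
  refine h2.congr_of_eventuallyEq ?_
  filter_upwards [hs, e.open_baseSet.mem_nhds
    (FiberBundle.mem_baseSet_trivializationAt F V x₀)] with x hx hx'
  have h3 : (t : ∀ x, V x) x = (2 * g.pairing x ((σ : ∀ x : M, Covector n x) x)
      ((ρ : ∀ x : M, Covector n x) x)) • (s : ∀ x, V x) x := c.clifford x _ _ _
  rw [h3, (e.linear ℂ hx').map_smul, hx, map_smul, hl, smul_eq_mul, mul_one,
    inv_mul_cancel_left₀ two_ne_zero]

/-- The function `⟨σ, ρ⟩`. -/
def pairing (c : CliffordRepresentation g F V) (σ ρ : OneForm n M) : SmoothFun n M :=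
  ⟨fun x => g.pairing x ((σ : ∀ x : M, Covector n x) x) ((ρ : ∀ x : M, Covector n x) x),
    c.contMDiff_pairing σ ρ, σ.2.2.of_isClosed_subset (isClosed_tsupport _)
      (closure_mono fun x hx h0 => hx (by
        beta_reduce
        rw [h0, PseudoRiemannianMetric.pairing]
        exact (congrArg (0 + ·) (mul_zero _)).trans (add_zero 0)))⟩

end CliffordRepresentation

namespace DeformedSpectralTriple

variable {𝕜 𝔸 𝕍 : Type*} [CommRing 𝕜] [Algebra ℂ 𝕜]
  [NonUnitalRing 𝔸] [Module ℂ 𝔸] [Module 𝕜 𝔸] [IsScalarTower ℂ 𝕜 𝔸] [IsScalarTower 𝕜 𝔸 𝔸]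
  [SMulCommClass 𝕜 𝔸 𝔸] [AddCommGroup 𝕍] [Module ℂ 𝕍] [Module 𝕜 𝕍] [IsScalarTower ℂ 𝕜 𝕍]
  (T : DeformedSpectralTriple g F V 𝕜 𝔸 𝕍)

/-- True for the generators `[D, a]`, and preserved by composing with left multiplications because
these commute with right ones. -/
theorem ncForms_right (α : T.bimod.ncForms T.D) (b : 𝔸) (v : 𝕍) :
    (α : Module.End 𝕜 𝕍) (T.bimod.right b v) = T.bimod.right b ((α : Module.End 𝕜 𝕍) v) := by
  let S : Submodule 𝕜 (Module.End 𝕜 𝕍) :=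
    { carrier := {X | ∀ b v, X (T.bimod.right b v) = T.bimod.right b (X v)}
      zero_mem' := fun b v => by simp
      add_mem' := fun {X Y} hX hY b v => by simp [hX b v, hY b v]
      smul_mem' := fun c X hX b v => by simp [hX b v] }
  have hS : T.bimod.ncForms T.D ≤ S := by
    refine sInf_le ⟨fun a b v => T.commutator_right a b v, fun a X hX b v => ?_,
      fun a X hX b v => ?_⟩
    · rw [Module.End.mul_apply, Module.End.mul_apply, hX, T.bimod.left_right]
    · rw [Module.End.mul_apply, Module.End.mul_apply, T.bimod.left_right, hX]
  exact hS α.2 b v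

theorem formProj_commutator (a : 𝔸) :
    T.formProj ⟨T.bimod.commutator T.D a, T.bimod.commutator_mem T.D a⟩ =
      Complex.I • gradient (T.deformation.proj a) := by
  rw [← T.formProj_ncDiff, ← map_smul, Bimodule.ncDiff, smul_smul]
  simp

variable [T2Space M]

/-- Modulo `κ`, noncommutative `1`-forms act by Clifford multiplication. -/
theorem proj_ncForms_apply (α : T.bimod.ncForms T.D) (v : 𝕍) :
    T.proj ((α : Module.End 𝕜 𝕍) v) = T.clifford.act (T.formProj α) (T.proj v) := by
  let S : Submodule 𝕜 (Module.End 𝕜 𝕍) :=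
    { carrier := {X | ∃ hX : X ∈ T.bimod.ncForms T.D, ∀ v,
        T.proj (X v) = T.clifford.act (T.formProj ⟨X, hX⟩) (T.proj v)}
      zero_mem' := ⟨zero_mem _, fun v => Sections.ext fun x => by
        have h0 : T.formProj ⟨0, zero_mem _⟩ = 0 := map_zero T.formProj
        rw [h0, LinearMap.zero_apply, map_zero]
        exact (LinearMap.congr_fun (map_zero (T.clifford.toFun x)) _).symm⟩
      add_mem' := fun {X Y} ⟨hX, h⟩ ⟨hY, h'⟩ => ⟨add_mem hX hY, fun v => Sections.ext fun x => by
        have h0 : T.formProj ⟨X + Y, add_mem hX hY⟩ = T.formProj ⟨X, hX⟩ + T.formProj ⟨Y, hY⟩ :=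
          map_add T.formProj ⟨X, hX⟩ ⟨Y, hY⟩
        rw [h0, LinearMap.add_apply, map_add, h, h', Sections.coe_add_apply]
        simp only [CliffordRepresentation.act_apply, OneForm.coe_add_apply, map_add,
          LinearMap.add_apply]⟩
      -- With `a` reducing to a function equal to `1` at `x`, the scalar `k` acts at `x` through the
      -- value of the class of `k a`, and this number is the same for sections and for forms.
      smul_mem' := fun k X ⟨hX, h⟩ => ⟨Submodule.smul_mem _ k hX, fun v => Sections.ext fun x => by
        obtain ⟨f, hf⟩ := SmoothFun.exists_apply_eq_one (n := n) x
        obtain ⟨a, rfl⟩ := T.deformation.proj_surjective f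
        have h1 := congrArg (fun s : Sections n F V => (s : ∀ x, V x) x)
          (T.isBimoduleDeformation.smul_proj_smul k a (X v))
        have h2 := congrArg (fun s : OneForm n M => (s : ∀ x, Covector n x) x)
          (T.isFormDeformation.smul_proj_smul k a ⟨X, hX⟩)
        simp only [Sections.coe_smul_apply, OneForm.coe_smul_apply, hf, one_smul] at h1 h2
        rw [LinearMap.smul_apply, h1, h v]
        simp only [CliffordRepresentation.act_apply]
        have h3 : (T.formProj ⟨k • X, Submodule.smul_mem _ k hX⟩ : ∀ x, Covector n x) x =
          (T.deformation.proj (k • a) : M → ℂ) x •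
            (T.formProj ⟨X, hX⟩ : ∀ x, Covector n x) x := h2
        rw [h3, map_smul (T.clifford.toFun x), LinearMap.smul_apply]⟩ }
  have hS : T.bimod.ncForms T.D ≤ S := by
    refine sInf_le ⟨fun a => ⟨T.bimod.commutator_mem T.D a, fun v => ?_⟩,
      fun a X ⟨hX, h⟩ => ⟨T.bimod.left_mul_mem T.D a hX, fun v => ?_⟩,
      fun a X ⟨hX, h⟩ => ⟨T.bimod.mul_left_mem T.D a hX, fun v => ?_⟩⟩
    · have h1 : T.proj (T.bimod.commutator T.D a v) =
          T.D₀ (T.deformation.proj a • T.proj v) - T.deformation.proj a • T.D₀ (T.proj v) := by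
        rw [← T.isBimoduleDeformation.map_left, ← T.proj_D, ← T.proj_D,
          ← T.isBimoduleDeformation.map_left, ← map_sub]
        rfl
      rw [h1, T.isDiracType, T.formProj_commutator]
      refine Sections.ext fun x => ?_
      rw [Sections.coe_const_smul_apply, CliffordRepresentation.act_apply,
        CliffordRepresentation.act_apply, OneForm.coe_const_smul_apply, map_smul,
        LinearMap.smul_apply]
    · have h1 : T.formProj ⟨T.bimod.left a * X, T.bimod.left_mul_mem T.D a hX⟩ =
          T.deformation.proj a • T.formProj ⟨X, hX⟩ := T.isFormDeformation.map_left a ⟨X, hX⟩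
      rw [h1, Module.End.mul_apply, T.isBimoduleDeformation.map_left, h]
      refine Sections.ext fun x => ?_
      rw [Sections.coe_smul_apply, CliffordRepresentation.act_apply,
        CliffordRepresentation.act_apply, OneForm.coe_smul_apply, map_smul, LinearMap.smul_apply]
    · have h1 : T.formProj ⟨X * T.bimod.left a, T.bimod.mul_left_mem T.D a hX⟩ =
          T.deformation.proj a • T.formProj ⟨X, hX⟩ := T.isFormDeformation.map_right a ⟨X, hX⟩
      rw [h1, Module.End.mul_apply, h, T.isBimoduleDeformation.map_left]
      refine Sections.ext fun x => ?_
      rw [CliffordRepresentation.act_apply, CliffordRepresentation.act_apply,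
        OneForm.coe_smul_apply, Sections.coe_smul_apply, map_smul, map_smul,
        LinearMap.smul_apply]
  obtain ⟨_, h⟩ := hS α.2
  exact h v

end DeformedSpectralTriple

end Spectral

/-! ### Compatibility of the bracket with the differential and with the metric -/

section Metric

variable {n : ℕ} {M : Type*} [TopologicalSpace M] [ChartedSpace (EuclideanSpace ℝ (Fin n)) M]
  [IsManifold (𝓡 n) ∞ M] {g : PseudoRiemannianMetric n M}
  {F : Type*} [NormedAddCommGroup F] [NormedSpace ℂ F]
  {V : M → Type*} [TopologicalSpace (TotalSpace F V)] [∀ x, AddCommGroup (V x)]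
  [∀ x, Module ℂ (V x)] [∀ x, TopologicalSpace (V x)] [FiberBundle F V] [VectorBundle ℂ F V]
  {𝕜 𝔸 𝕍 : Type*} [CommRing 𝕜] [Algebra ℂ 𝕜]
  [NonUnitalRing 𝔸] [Module ℂ 𝔸] [Module 𝕜 𝔸] [IsScalarTower ℂ 𝕜 𝔸] [IsScalarTower 𝕜 𝔸 𝔸]
  [SMulCommClass 𝕜 𝔸 𝔸] [AddCommGroup 𝕍] [Module ℂ 𝕍] [Module 𝕜 𝕍] [IsScalarTower ℂ 𝕜 𝕍]
  (T : DeformedSpectralTriple g F V 𝕜 𝔸 𝕍)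

namespace DeformedSpectralTriple

/-- An operator that commutes with right multiplications and vanishes modulo `κ` commutes with left
multiplications modulo `κ²`. -/
theorem exists_commutator_eq_sq_smul {R : Module.End 𝕜 𝕍}
    (hR : ∀ v, ∃ u, R v = T.deformation.κ • u)
    (hright : ∀ b v, R (T.bimod.right b v) = T.bimod.right b (R v)) (a : 𝔸) (v : 𝕍) :
    ∃ r, T.bimod.left a (R v) - R (T.bimod.left a v) = T.deformation.κ ^ 2 • r := by
  obtain ⟨u, hu⟩ := hR v
  have h (w : 𝕍) : ∃ z, T.bimod.left a w = T.bimod.right a w + T.deformation.κ • z :=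
    T.isBimoduleDeformation.exists_eq_add_smul
      ((T.isBimoduleDeformation.map_left a w).trans (T.isBimoduleDeformation.map_right a w).symm)
  obtain ⟨y, hy⟩ := h v
  obtain ⟨z, hz⟩ := h u
  obtain ⟨t, ht⟩ := hR y
  -- With `a v = v a + κ y` and `a u = u a + κ z`, both terms equal `κ (u a)` up to order `κ²`; the
  -- errors are `κ² z` and `κ R y = κ² t`.
  refine ⟨z - t, ?_⟩
  rw [hy, map_add, hright, map_smul, ht, hu, map_smul, map_smul, hz]
  module

/-- Apply the derivation `d` to `i [a, b]` and divide by `κ`. This is the torsion-free condition on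
exact forms. -/
theorem gradient_bracket (f h : SmoothFun n M) :
    gradient (T.deformation.bracket f h) =
      T.isFormDeformation.bracket f (gradient h) - T.isFormDeformation.bracket h (gradient f) := by
  obtain ⟨a, rfl⟩ := T.deformation.proj_surjective f
  obtain ⟨b, rfl⟩ := T.deformation.proj_surjective h
  obtain ⟨c, hc⟩ := T.deformation.isBimoduleDeformation_self.exists_ad_eq a b
  obtain ⟨α, hα⟩ := T.isFormDeformation.exists_ad_eq a (T.bimod.ncDiff T.D b)
  obtain ⟨β, hβ⟩ := T.isFormDeformation.exists_ad_eq b (T.bimod.ncDiff T.D a)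
  have h1 : T.deformation.bracket (T.deformation.proj a) (T.deformation.proj b) =
    T.deformation.proj c := T.deformation.isBimoduleDeformation_self.bracket_eq hc
  rw [h1, ← T.formProj_ncDiff, ← T.formProj_ncDiff, ← T.formProj_ncDiff,
    T.isFormDeformation.bracket_eq hα, T.isFormDeformation.bracket_eq hβ]
  refine Eq.trans ?_ (map_sub T.formProj α β)
  refine T.isFormDeformation.proj_eq_of_smul_eq (r := 0) ?_
  rw [smul_zero, add_zero, smul_sub, ← hα, ← hβ]
  have h2 : T.deformation.κ • T.bimod.ncDiff T.D c =
      T.bimod.ncDiff T.D (T.deformation.κ • c) := by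
    ext v
    simp only [Bimodule.ncDiff, Bimodule.commutator, ← algebraMap_smul 𝕜 (-Complex.I),
      Submodule.coe_smul, LinearMap.smul_apply, LinearMap.sub_apply, Module.End.mul_apply,
      map_smul]
    module
  rw [h2, ← hc]
  ext v
  simp only [Bimodule.ncDiff, Bimodule.commutator, ← algebraMap_smul 𝕜 (-Complex.I),
    Submodule.coe_smul, LinearMap.smul_apply, LinearMap.sub_apply, Module.End.mul_apply,
    Bimodule.ad_apply, selfBimodule_left, selfBimodule_right, map_smul, map_sub,
    Bimodule.ncFormsBimodule, LinearMap.mk₂_apply, Submodule.coe_sub, T.bimod.left_mul]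
  module

variable [T2Space M] [Nontrivial F] [VectorBundle ℝ F V] [ContMDiffVectorBundle ∞ F V (𝓡 n)]

/-- Commute `a` with the operator form of the Clifford relation: its defect `R` commutes with right
multiplications and vanishes modulo `κ`, so `[a, R]` does not contribute at order `κ`. -/
theorem bracket_pairing (f : SmoothFun n M) (σ ρ : OneForm n M) :
    T.deformation.bracket f (T.clifford.pairing σ ρ) =
      T.clifford.pairing (T.isFormDeformation.bracket f σ) ρ +
        T.clifford.pairing σ (T.isFormDeformation.bracket f ρ) := by
  obtain ⟨a, rfl⟩ := T.deformation.proj_surjective f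
  obtain ⟨α, rfl⟩ := T.isFormDeformation.surjective σ
  obtain ⟨β, rfl⟩ := T.isFormDeformation.surjective ρ
  obtain ⟨b, hb⟩ := T.deformation.proj_surjective
    ((2 : ℂ) • T.clifford.pairing (T.formProj α) (T.formProj β))
  obtain ⟨c, hc⟩ := T.deformation.isBimoduleDeformation_self.exists_ad_eq a b
  obtain ⟨α', hα'⟩ := T.isFormDeformation.exists_ad_eq a α
  obtain ⟨β', hβ'⟩ := T.isFormDeformation.exists_ad_eq a β
  have h1 : T.deformation.bracket (T.deformation.proj a) (T.deformation.proj b) =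
    T.deformation.proj c := T.deformation.isBimoduleDeformation_self.bracket_eq hc
  rw [hb, map_smul] at h1
  rw [T.isFormDeformation.bracket_eq hα', T.isFormDeformation.bracket_eq hβ']
  let R : Module.End 𝕜 𝕍 := (α : Module.End 𝕜 𝕍) * (β : Module.End 𝕜 𝕍) +
    (β : Module.End 𝕜 𝕍) * (α : Module.End 𝕜 𝕍) - T.bimod.left b
  have hRv (v : 𝕍) : R v = (α : Module.End 𝕜 𝕍) ((β : Module.End 𝕜 𝕍) v) +
    (β : Module.End 𝕜 𝕍) ((α : Module.End 𝕜 𝕍) v) - T.bimod.left b v := rfl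
  have hR (v : 𝕍) : ∃ u, R v = T.deformation.κ • u := by
    rw [← T.isBimoduleDeformation.eq_zero_iff, hRv, map_sub, map_add, T.proj_ncForms_apply,
      T.proj_ncForms_apply, T.proj_ncForms_apply, T.proj_ncForms_apply,
      T.isBimoduleDeformation.map_left, hb]
    refine Sections.ext fun x => ?_
    rw [Sections.coe_sub_apply, Sections.coe_add_apply, Sections.coe_smul_apply]
    simp only [CliffordRepresentation.act_apply]
    rw [T.clifford.clifford]
    exact sub_self _
  have hright (d : 𝔸) (v : 𝕍) : R (T.bimod.right d v) = T.bimod.right d (R v) := by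
    simp only [hRv, T.ncForms_right, T.bimod.left_right, map_add, map_sub]
  -- Modulo `κ`, this is `i [a, αβ + βα - b] / κ = 0` expanded by the Leibniz rule for commutators.
  have key (v : 𝕍) : T.proj ((α' : Module.End 𝕜 𝕍) ((β : Module.End 𝕜 𝕍) v) +
      (α : Module.End 𝕜 𝕍) ((β' : Module.End 𝕜 𝕍) v) +
      ((β' : Module.End 𝕜 𝕍) ((α : Module.End 𝕜 𝕍) v) +
      (β : Module.End 𝕜 𝕍) ((α' : Module.End 𝕜 𝕍) v))) = T.proj (T.bimod.left c v) := by
    obtain ⟨r, hr⟩ := T.exists_commutator_eq_sq_smul hR hright a v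
    refine T.isBimoduleDeformation.proj_eq_of_smul_eq (r := algebraMap ℂ 𝕜 Complex.I • r) ?_
    have hα (v : 𝕍) : T.deformation.κ • (α' : Module.End 𝕜 𝕍) v = algebraMap ℂ 𝕜 Complex.I •
        (T.bimod.left a ((α : Module.End 𝕜 𝕍) v) - (α : Module.End 𝕜 𝕍) (T.bimod.left a v)) :=
      (congrArg (fun X : T.bimod.ncForms T.D => (X : Module.End 𝕜 𝕍) v) hα').symm
    have hβ (v : 𝕍) : T.deformation.κ • (β' : Module.End 𝕜 𝕍) v = algebraMap ℂ 𝕜 Complex.I •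
        (T.bimod.left a ((β : Module.End 𝕜 𝕍) v) - (β : Module.End 𝕜 𝕍) (T.bimod.left a v)) :=
      (congrArg (fun X : T.bimod.ncForms T.D => (X : Module.End 𝕜 𝕍) v) hβ').symm
    have k1 : T.deformation.κ • (α : Module.End 𝕜 𝕍) ((β' : Module.End 𝕜 𝕍) v) =
        algebraMap ℂ 𝕜 Complex.I • ((α : Module.End 𝕜 𝕍) (T.bimod.left a
          ((β : Module.End 𝕜 𝕍) v)) - (α : Module.End 𝕜 𝕍)
            ((β : Module.End 𝕜 𝕍) (T.bimod.left a v))) := by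
      rw [← map_smul, hβ, map_smul, map_sub]
    have k2 : T.deformation.κ • (β : Module.End 𝕜 𝕍) ((α' : Module.End 𝕜 𝕍) v) =
        algebraMap ℂ 𝕜 Complex.I • ((β : Module.End 𝕜 𝕍) (T.bimod.left a
          ((α : Module.End 𝕜 𝕍) v)) - (β : Module.End 𝕜 𝕍)
            ((α : Module.End 𝕜 𝕍) (T.bimod.left a v))) := by
      rw [← map_smul, hα, map_smul, map_sub]
    have k3 : T.deformation.κ • T.bimod.left c v = algebraMap ℂ 𝕜 Complex.I •
        (T.bimod.left a (T.bimod.left b v) - T.bimod.left b (T.bimod.left a v)) := by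
      rw [← LinearMap.smul_apply, ← map_smul, ← hc, Bimodule.ad_apply, map_smul, map_sub,
        selfBimodule_left, selfBimodule_right, LinearMap.smul_apply, LinearMap.sub_apply,
        T.bimod.left_mul, T.bimod.left_mul]
    rw [smul_comm (T.deformation.κ ^ 2), ← hr, smul_add, smul_add, smul_add, hα, hβ, k1, k2, k3,
      hRv, hRv]
    simp only [map_add, map_sub]
    module
  refine SmoothFun.ext fun x => ?_
  -- The identity so far is between operators. By the Clifford relation both sides act at `x` as
  -- scalars, which can be compared on a vector that is nonzero at `x`.
  obtain ⟨w, hw⟩ := exists_ne (0 : F)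
  obtain ⟨s, hs⟩ := Sections.exists_trivialization_eq (n := n) (V := V) x w
  obtain ⟨v, rfl⟩ := T.isBimoduleDeformation.surjective s
  have hsx : (T.proj v : ∀ x, V x) x ≠ 0 := by
    intro h0
    have h2 := hs.self_of_nhds
    rw [h0, ((trivializationAt F V x).linear ℂ
      (FiberBundle.mem_baseSet_trivializationAt F V x)).map_zero] at h2
    exact hw h2.symm
  have h3 := congrArg (fun s : Sections n F V => (s : ∀ x, V x) x) (key v)
  simp only [map_add, T.proj_ncForms_apply, T.isBimoduleDeformation.map_left,
    Sections.coe_add_apply, Sections.coe_smul_apply, CliffordRepresentation.act_apply, ← h1] at h3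
  have k1 := T.clifford.clifford x ((T.formProj α' : ∀ x : M, Covector n x) x)
    ((T.formProj β : ∀ x : M, Covector n x) x) ((T.proj v : ∀ x, V x) x)
  have k2 := T.clifford.clifford x ((T.formProj α : ∀ x : M, Covector n x) x)
    ((T.formProj β' : ∀ x : M, Covector n x) x) ((T.proj v : ∀ x, V x) x)
  have h4 : (2 * (T.clifford.pairing (T.formProj α') (T.formProj β) : M → ℂ) x +
      2 * (T.clifford.pairing (T.formProj α) (T.formProj β') : M → ℂ) x -
      2 * (T.deformation.bracket (T.deformation.proj a)
        (T.clifford.pairing (T.formProj α) (T.formProj β)) : M → ℂ) x) • (T.proj v : ∀ x, V x) x = 0 := by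
    rw [sub_smul, add_smul]
    refine (congrArg₂ (· - ·) (congrArg₂ (· + ·) k1.symm k2.symm) h3.symm).trans ?_
    abel
  have h5 := (smul_eq_zero.1 h4).resolve_right hsx
  change _ = (T.clifford.pairing (T.formProj α') (T.formProj β) : M → ℂ) x +
    (T.clifford.pairing (T.formProj α) (T.formProj β') : M → ℂ) x
  linear_combination (-1 / 2 : ℂ) * h5

end DeformedSpectralTriple

end Metric

/-! ### Construction and flatness of the metric connection -/

section MetricConnection

variable {n : ℕ} {M : Type*} [TopologicalSpace M] [T2Space M]
  [ChartedSpace (EuclideanSpace ℝ (Fin n)) M]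
  [IsManifold (𝓡 n) ∞ M] {g : PseudoRiemannianMetric n M}
  {F : Type*} [NormedAddCommGroup F] [NormedSpace ℂ F] [Nontrivial F]
  {V : M → Type*} [TopologicalSpace (TotalSpace F V)] [∀ x, AddCommGroup (V x)]
  [∀ x, Module ℂ (V x)] [∀ x, TopologicalSpace (V x)] [FiberBundle F V] [VectorBundle ℂ F V]
  [VectorBundle ℝ F V] [ContMDiffVectorBundle ∞ F V (𝓡 n)]
  {𝕜 𝔸 𝕍 : Type*} [CommRing 𝕜] [Algebra ℂ 𝕜]
  [NonUnitalRing 𝔸] [Module ℂ 𝔸] [Module 𝕜 𝔸] [IsScalarTower ℂ 𝕜 𝔸] [IsScalarTower 𝕜 𝔸 𝔸]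
  [SMulCommClass 𝕜 𝔸 𝔸] [AddCommGroup 𝕍] [Module ℂ 𝕍] [Module 𝕜 𝕍] [IsScalarTower ℂ 𝕜 𝕍]
  (T : DeformedSpectralTriple g F V 𝕜 𝔸 𝕍) {P : PoissonStructure n M}

namespace DeformedSpectralTriple

/-- The bracket of functions with noncommutative `1`-forms defines the metric contravariant
connection. -/
theorem exists_metricConnection (hP : T.deformation.IsPoissonStructure P) :
    ∃ B, P.IsKoszulBracket B ∧ ∃ 𝒟 : ContravariantConnection P, 𝒟.IsMetricConnection B g ∧
      ∀ h ρ, 𝒟.toFun (gradient h) ρ = T.isFormDeformation.bracket h ρ := by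
  have hP' := (T.deformation.isPoissonStructure_iff P).1 hP
  obtain ⟨𝒟, h𝒟⟩ := T.isFormDeformation.exists_contravariantConnection hP'
  have h1 (h : SmoothFun n M) (ρ : OneForm n M) :
      𝒟.toFun (gradient h) ρ = T.isFormDeformation.bracket h ρ :=
    OneForm.ext fun x => h𝒟 _ ρ h x rfl
  obtain ⟨B, hB, hB'⟩ := 𝒟.exists_isKoszulBracket fun f h => by
    rw [h1, h1, hP', T.gradient_bracket]
  refine ⟨B, hB, 𝒟, ⟨fun σ ρ => ?_, fun σ β γ x => ?_⟩, h1⟩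
  · rw [ContravariantConnection.torsion, hB']
    abel
  -- Metric compatibility is pointwise in `σ`, so `σ` is replaced by a differential agreeing with it
  -- at `x`, and `bracket_pairing` applies.
  · obtain ⟨h, hh⟩ := exists_gradient_apply_eq x ((σ : ∀ x : M, Covector n x) x)
    rw [h𝒟 σ β h x hh.symm, h𝒟 σ γ h x hh.symm, ← hh]
    have h2 := congrArg (fun f : SmoothFun n M => (f : M → ℂ) x)
      ((hP' h (T.clifford.pairing β γ)).trans (T.bracket_pairing h β γ))
    exact h2

omit [Nontrivial F] [VectorBundle ℝ F V] [ContMDiffVectorBundle ∞ F V (𝓡 n)] in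
/-- The Jacobi identity for commutators gives flatness. -/
theorem isFlat_of_toFun_gradient (hP : T.deformation.IsPoissonStructure P)
    {B : OneForm n M →ₗ[ℂ] OneForm n M →ₗ[ℂ] OneForm n M} (hB : P.IsKoszulBracket B)
    {𝒟 : ContravariantConnection P}
    (h𝒟 : ∀ h ρ, 𝒟.toFun (gradient h) ρ = T.isFormDeformation.bracket h ρ) : 𝒟.IsFlat B := by
  refine ContravariantConnection.isFlat_of_gradient hB 𝒟 fun f k τ => ?_
  rw [ContravariantConnection.curvature, hB.gradient,
    (T.deformation.isPoissonStructure_iff P).1 hP, h𝒟, h𝒟, h𝒟, h𝒟, h𝒟]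
  have h1 (σ : OneForm n M) : σ - σ = 0 := by abel
  exact (congrArg (· - _) (T.isFormDeformation.bracket_bracket f k τ)).trans (h1 _)

end DeformedSpectralTriple

end MetricConnection

end DeformedGeometry

end

theorem mainTheorem1 {n : ℕ} {M : Type*} [TopologicalSpace M] [T2Space M] [SigmaCompactSpace M]
    [ChartedSpace (EuclideanSpace ℝ (Fin n)) M] [IsManifold (𝓡 n) ∞ M]
    (g : DeformedGeometry.PseudoRiemannianMetric n M)
    (F : Type*) [NormedAddCommGroup F] [NormedSpace ℂ F] [FiniteDimensional ℂ F] [Nontrivial F]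
    (V : M → Type*) [TopologicalSpace (TotalSpace F V)] [∀ x, AddCommGroup (V x)]
    [∀ x, Module ℂ (V x)] [∀ x, TopologicalSpace (V x)] [FiberBundle F V]
    [VectorBundle ℂ F V] [VectorBundle ℝ F V] [ContMDiffVectorBundle ∞ F V (𝓡 n)]
    {𝕜 𝔸 𝕍 : Type*} [CommRing 𝕜] [Algebra ℂ 𝕜]
    [NonUnitalRing 𝔸] [Module ℂ 𝔸] [Module 𝕜 𝔸] [IsScalarTower ℂ 𝕜 𝔸] [IsScalarTower 𝕜 𝔸 𝔸]
    [SMulCommClass 𝕜 𝔸 𝔸] [AddCommGroup 𝕍] [Module ℂ 𝕍] [Module 𝕜 𝕍] [IsScalarTower ℂ 𝕜 𝕍]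
    (T : DeformedGeometry.DeformedSpectralTriple g F V 𝕜 𝔸 𝕍) :
    (∃! P : DeformedGeometry.PoissonStructure n M, T.deformation.IsPoissonStructure P) ∧
    ∀ P : DeformedGeometry.PoissonStructure n M, T.deformation.IsPoissonStructure P →
      (∃! B, P.IsKoszulBracket B) ∧
      ∀ B, P.IsKoszulBracket B →
        (∃! 𝒟 : DeformedGeometry.ContravariantConnection P, 𝒟.IsMetricConnection B g) ∧
        ∀ 𝒟 : DeformedGeometry.ContravariantConnection P,
          𝒟.IsMetricConnection B g → 𝒟.IsFlat B := by
  refine ⟨T.deformation.existsUnique_isPoissonStructure, fun P hP => ?_⟩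
  obtain ⟨B₀, hB₀, 𝒟₀, h𝒟₀, h⟩ := T.exists_metricConnection hP
  refine ⟨⟨B₀, hB₀, fun B hB => hB.eq hB₀⟩, fun B hB => ?_⟩
  obtain rfl := hB.eq hB₀
  refine ⟨⟨𝒟₀, h𝒟₀, fun 𝒟 h𝒟 => h𝒟.eq h𝒟₀⟩, fun 𝒟 h𝒟 => ?_⟩
  -- By uniqueness an arbitrary metric connection is the one defined by commutators, for which
  -- flatness is the Jacobi identity.
  obtain rfl := h𝒟.eq h𝒟₀
  exact T.isFlat_of_toFun_gradient hP hB h
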